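/- Let $q>0$, $\sigma>0$, $h>0$, $\lambda_n=n^2$, $\varphi_0(x)=1/\sqrt\pi$ and $\varphi_n(x)=\sqrt{2/\pi}\cos nx$ $(n\ge1)$. Let $f\in C([0,\infty)\times L^2(0,\pi);L^2(0,\pi))$ satisfy $f(t,0)=0$ and $\|f(t,z_1)-f(t,z_2)\|\le\sigma\|z_1-z_2\|$ for all $t\ge0$, $z_1,z_2\in L^2(0,\pi)$. Let $0=t_0<t_1<t_2<\cdots$, $t_{k+1}-t_k\le h$ for all $k$, $t_k\to\infty$. Consider the semilinear heat equation with sampled input $u(t_k)$ and output $y$: $$z_t=z_{xx}+qz+f(t,z(\cdot,t)),\quad z_x(0,t)=0,\quad z_x(\pi,t)=u(t_k)\ \text{ for } t \text{ between } t_k \text{ and } t_{k+1},\qquad y(t)=z(0,t).$$ Let $N\in\mathbb N$ with $\lambda_N>q+\sigma$, $\gamma=\frac2\pi\sum_{n=N}^\infty\frac1{\lambda_n-q-\sigma}$, $A=\mathrm{diag}(q-\lambda_0,\dots,q-\lambda_{N-1})$, $B=[\varphi_0(\pi),\dots,\varphi_{N-1}(\pi)]^\top$, $C=[\varphi_0(0),\dots,\varphi_{N-1}(0)]$.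 **Theorem (stability under sample-and-hold).** Let the symmetric positive definite matrices $X,Z\in\mathbb R^{N\times N}$ be stabilizing solutions of $$XA+A^\top X-X(BB^\top-\gamma\sigma I)X+\tfrac\sigma\gamma I=0,\qquad ZA^\top+AZ-Z(C^\top C-\gamma\sigma I)Z+\tfrac\sigma\gamma I=0$$ (that is, $A-(BB^\top-\gamma\sigma I)X$ and $A^\top-(C^\top C-\gamma\sigma I)Z$ are Hurwitz) with spectral radius $\rho(XZ)<\gamma^{-2}$, and put $K=B^\top X$, $L=Z(I-\gamma^2XZ)^{-1}C^\top$. Suppose that there are symmetric positive definite $N\times N$ matrices $P_z,P_e,W_z,W_e$ with $\Psi\le0$ (negative semidefinite), where $\Psi$ is the symmetric block matrix $$\Psi=\left[\begin{smallmatrix} \Psi_{11} & \Psi_{12} & \gamma\sigma P_z & 0 & K^\top K-P_zBK & K^\top K-P_zBK & h(A-BK)^\top W_z & h\gamma\sigma XW_e\\ * & \Psi_{22} & -\gamma\sigma P_e & P_eL & K^\top K & K^\top K & -hK^\top B^\top W_z & h(A-LC+\gamma\sigma X)^\top W_e \\ * & * & -\gamma\sigma I & 0 & 0 & 0 & h\gamma\sigma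 W_z & -h\gamma\sigma W_e \\ * & * & * & -\gamma^{-2} & 0 & 0 & 0 & hL^\top W_e \\ * & * & * & * & -\frac{\pi^2}4W_z+K^\top K & K^\top K & -hK^\top B^\top W_z & 0 \\ * & * & * & * & * & -\frac{\pi^2}4W_e+K^\top K & -hK^\top B^\top W_z & 0 \\ * & * & * & * & * & * & -W_z & 0 \\ * & * & * & * & * & * & * & -W_e \end{smallmatrix}\right],$$ $\Psi_{11}=P_z(A-BK)+(A-BK)^\top P_z+K^\top K+\frac\sigma\gamma I$, $\Psi_{12}=-P_zBK+\gamma\sigma XP_e+K^\top K$, $\Psi_{22}=P_e(A-LC+\gamma\sigma X)+(A-LC+\gamma\sigma X)^\top P_e+K^\top K$. Then the sampled-data observer-based controller $$\dot{\hat z}^N(t)=(A+\gamma\sigma X)\hat z^N(t)+Bu(t_k)-L\bigl(C\hat z^N(t)-y(t)\bigr)\ \text{ for } t\in(t_k,t_{k+1}),\qquad u(t_k)=-K\hat z^N(t_k),\qquad \hat z^N(0)=0,$$ with $\hat z^N$ continuous on $[0,\infty)$, stabilizes the zero solution in the $L^2$ norm: there is $M\ge1$, independent of the solution, of $f$ (within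 the class above) and of the sampling instants, such that every classical solution of the closed loop satisfies $$\|z(\cdot,t)\|^2+|e^N(t)|^2\le M\|z(\cdot,0)\|^2,\qquad t\ge0,$$ where $e^N=\hat z^N-z^N$, $z^N=[\langle z,\varphi_0\rangle,\dots,\langle z,\varphi_{N-1}\rangle]^\top$, and $|\cdot|$ is the Euclidean norm. Here a classical solution is a function $z\in C([0,\infty);L^2(0,\pi))\cap C^1((0,\infty)\setminus\{t_k\}_k;L^2(0,\pi))$ with $z(\cdot,t)\in H^2(0,\pi)$ for all $t>0$, for which the equation and the boundary conditions hold on every open interval $(t_k,t_{k+1})$. -/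

import Mathlib

open MeasureTheory Set Filter Topology
open scoped Matrix ContDiff

noncomputable section

namespace HeatControl

/-! ### The space `L²(0, π)`, weak derivatives and point values -/

/-- The real Hilbert space `L²(0, π)`. -/
abbrev L2 : Type := Lp ℝ 2 (volume.restrict (Ioo (0 : ℝ) Real.pi))

/-- `g' ∈ L²(0, π)` is the weak derivative of `g ∈ L²(0, π)`. -/
def HasWeakDeriv (g g' : L2) : Prop :=
  ∀ η : ℝ → ℝ, ContDiff ℝ ∞ η → HasCompactSupport η → tsupport η ⊆ Ioo 0 Real.pi →
    ∫ x in Ioo 0 Real.pi, g x * deriv η x = -∫ x in Ioo 0 Real.pi, g' x * η x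

/-- The Sobolev space `H²(0, π)`. -/
def MemH2 (g : L2) : Prop :=
  ∃ g' g'' : L2, HasWeakDeriv g g' ∧ HasWeakDeriv g' g''

/-- The class `g` has a representative that is continuous on `[0, π]` and takes the value `v`
at the point `x` (meant for `x ∈ [0, π]`; `v` is then unique). -/
def HasPointValue (g : L2) (x v : ℝ) : Prop :=
  ∃ c : ℝ → ℝ, ContinuousOn c (Icc 0 Real.pi) ∧
    (g : ℝ → ℝ) =ᵐ[volume.restrict (Ioo (0 : ℝ) Real.pi)] c ∧ c x = v

/-! ### Neumann eigenfunctions and modal data -/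

/-- The `n`-th Neumann eigenvalue `λ_n = n²`. -/
def eigval (n : ℕ) : ℝ := (n : ℝ) ^ 2

/-- The `n`-th normalized Neumann eigenfunction on `[0, π]`. -/
def eigfun (n : ℕ) (x : ℝ) : ℝ :=
  if n = 0 then 1 / √Real.pi else √(2 / Real.pi) * Real.cos (n * x)

/-- The Fourier coefficient `⟨w, φ_n⟩` of `w ∈ L²(0, π)`. -/
def fourierMode (w : L2) (n : ℕ) : ℝ := ∫ x in Ioo 0 Real.pi, w x * eigfun n x

/-- `A = diag(q - λ_0, …, q - λ_{N-1})`. -/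
def matA (q : ℝ) (N : ℕ) : Matrix (Fin N) (Fin N) ℝ :=
  Matrix.diagonal fun n => q - eigval n

/-- The column `B`, with entries `b_n = φ_n(π)`. -/
def matB (N : ℕ) : Matrix (Fin N) (Fin 1) ℝ := Matrix.of fun n _ => eigfun n Real.pi

/-- The row `C`, with entries `c_n = φ_n(0)`. -/
def matC (N : ℕ) : Matrix (Fin 1) (Fin N) ℝ := Matrix.of fun _ n => eigfun n 0

/-- The `L²` gain of the residue, `γ = (2/π) ∑_{n ≥ N} 1 / (λ_n - q - σ)`. -/
def gain (q σ : ℝ) (N : ℕ) : ℝ :=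
  2 / Real.pi * ∑' n : ℕ, 1 / (eigval (N + n) - q - σ)

/-! ### Riccati equations, spectral radius and gains -/

/-- All complex eigenvalues of the real matrix `M` lie in the open left half-plane. -/
def IsHurwitz {N : ℕ} (M : Matrix (Fin N) (Fin N) ℝ) : Prop :=
  ∀ μ ∈ spectrum ℂ (M.map Complex.ofReal), μ.re < 0

/-- `X` is a stabilizing solution of `X A + Aᵀ X - X S X + Q = 0`:
it solves the equation, and `A - S X` is Hurwitz. -/
def IsStabilizingRiccatiSolution {N : ℕ} (A S Q X : Matrix (Fin N) (Fin N) ℝ) : Prop :=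
  X * A + Aᵀ * X - X * S * X + Q = 0 ∧ IsHurwitz (A - S * X)

/-- The spectral radius `ρ(M)` of a real square matrix (over its complex eigenvalues). -/
def specRad {N : ℕ} (M : Matrix (Fin N) (Fin N) ℝ) : ENNReal :=
  spectralRadius ℂ (M.map Complex.ofReal)

/-- The controller gain `K = Bᵀ X`. -/
def gainK {N : ℕ} (X : Matrix (Fin N) (Fin N) ℝ) : Matrix (Fin 1) (Fin N) ℝ :=
  (matB N)ᵀ * X

/-- The observer gain `L = Z (I - γ² X Z)⁻¹ Cᵀ`. -/
def gainL {N : ℕ} (γ : ℝ) (X Z : Matrix (Fin N) (Fin N) ℝ) : Matrix (Fin N) (Fin 1) ℝ :=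
  Z * (1 - γ ^ 2 • (X * Z))⁻¹ * (matC N)ᵀ

/-! ### The matrix of the linear matrix inequality -/

/-- The symmetric block matrix with first diagonal block `D`, the blocks `R` to the right of it,
their transpose below it, and the remaining blocks `T`. -/
def symBlock {m n : Type*} (D : Matrix m m ℝ) (R : Matrix m n ℝ) (T : Matrix n n ℝ) :
    Matrix (m ⊕ n) (m ⊕ n) ℝ :=
  Matrix.fromBlocks D R Rᵀ T

/-- The index set of the `8 × 8` block matrix `Ψ`; the fourth block has size one. -/
abbrev PsiIndex (N : ℕ) : Type :=
  Fin N ⊕ Fin N ⊕ Fin N ⊕ Fin 1 ⊕ Fin N ⊕ Fin N ⊕ Fin N ⊕ Fin N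

open Matrix in
/-- The symmetric matrix `Ψ`, given by its upper triangular blocks, row after row. -/
def matPsi {N : ℕ} (σ γ h : ℝ) (A : Matrix (Fin N) (Fin N) ℝ) (B : Matrix (Fin N) (Fin 1) ℝ)
    (C K : Matrix (Fin 1) (Fin N) ℝ) (L : Matrix (Fin N) (Fin 1) ℝ)
    (X Pz Pe Wz We : Matrix (Fin N) (Fin N) ℝ) : Matrix (PsiIndex N) (PsiIndex N) ℝ :=
  -- row 1
  symBlock (Pz * (A - B * K) + (A - B * K)ᵀ * Pz + Kᵀ * K + (σ / γ) • 1)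
    (fromCols (-(Pz * B * K) + (γ * σ) • (X * Pe) + Kᵀ * K) <|
      fromCols ((γ * σ) • Pz) <|
      fromCols 0 <|
      fromCols (Kᵀ * K - Pz * B * K) <|
      fromCols (Kᵀ * K - Pz * B * K) <|
      fromCols (h • ((A - B * K)ᵀ * Wz)) ((h * γ * σ) • (X * We))) <|
  -- row 2
  symBlock (Pe * (A - L * C + (γ * σ) • X) + (A - L * C + (γ * σ) • X)ᵀ * Pe + Kᵀ * K)
    (fromCols (-((γ * σ) • Pe)) <|
      fromCols (Pe * L) <|
      fromCols (Kᵀ * K) <|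
      fromCols (Kᵀ * K) <|
      fromCols (-(h • (Kᵀ * Bᵀ * Wz))) (h • ((A - L * C + (γ * σ) • X)ᵀ * We))) <|
  -- row 3
  symBlock (-((γ * σ) • 1))
    (fromCols 0 <|
      fromCols 0 <|
      fromCols 0 <|
      fromCols ((h * γ * σ) • Wz) (-((h * γ * σ) • We))) <|
  -- row 4
  symBlock (-((γ ^ 2)⁻¹ • 1))
    (fromCols 0 <|
      fromCols 0 <|
      fromCols 0 (h • (Lᵀ * We))) <|
  -- row 5
  symBlock (-((Real.pi ^ 2 / 4) • Wz) + Kᵀ * K)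
    (fromCols (Kᵀ * K) <|
      fromCols (-(h • (Kᵀ * Bᵀ * Wz))) 0) <|
  -- row 6
  symBlock (-((Real.pi ^ 2 / 4) • We) + Kᵀ * K)
    (fromCols (-(h • (Kᵀ * Bᵀ * Wz))) 0) <|
  -- rows 7 and 8
  symBlock (-Wz) 0 (-We)

/-! ### The closed-loop system -/

/-- The nonlinearity: continuous on `[0, ∞) × L²(0, π)`, zero at the zero state, and Lipschitz
in the state with constant `σ`, uniformly in time. -/
structure IsAdmissibleNonlinearity (σ : ℝ) (f : ℝ → L2 → L2) : Prop where
  continuousOn : ContinuousOn (fun p : ℝ × L2 => f p.1 p.2) (Ici 0 ×ˢ univ)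
  map_zero : ∀ s, 0 ≤ s → f s 0 = 0
  lipschitz : ∀ s, 0 ≤ s → ∀ w₁ w₂ : L2, ‖f s w₁ - f s w₂‖ ≤ σ * ‖w₁ - w₂‖

/-- Sampling instants `0 = t_0 < t_1 < ⋯ → ∞` with `t_{k+1} - t_k ≤ h`. -/
structure IsSampling (h : ℝ) (t : ℕ → ℝ) : Prop where
  zero : t 0 = 0
  strictMono : StrictMono t
  step_le : ∀ k, t (k + 1) - t k ≤ h
  tendsto : Tendsto t atTop atTop

/-- `z` is a classical solution of the semilinear heat equation
`z_t = z_xx + q z + f(t, z)`, `z_x(0, t) = 0`, `z_x(π, t) = u_k` for `t` between `t_k` and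
`t_{k+1}`: it belongs to `C([0, ∞), L²) ∩ C¹((0, ∞) \ {t_k}, L²)`, takes values in `H²` for
positive times, and the equation and the boundary conditions hold between sampling instants. -/
structure IsPlantSolution (q : ℝ) (f : ℝ → L2 → L2) (t : ℕ → ℝ) (u : ℕ → ℝ)
    (z : ℝ → L2) : Prop where
  continuousOn : ContinuousOn z (Ici 0)
  contDiffOn : ContDiffOn ℝ 1 z (Ioi 0 \ range t)
  memH2 : ∀ s, 0 < s → MemH2 (z s)
  equation : ∀ k, ∀ s ∈ Ioo (t k) (t (k + 1)), ∃ zx zxx : L2,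
    HasWeakDeriv (z s) zx ∧ HasWeakDeriv zx zxx ∧
    HasPointValue zx 0 0 ∧ HasPointValue zx Real.pi (u k) ∧
    HasDerivAt z (zxx + q • z s + f s (z s)) s

/-- `zhat` is the state of the sampled-data observer-based controller with output `y`:
`zhat' = (A + γσX) zhat + B u_k - L (C zhat - y)` between `t_k` and `t_{k+1}`, `zhat(0) = 0`. -/
structure IsObserverSolution {N : ℕ} (q σ γ : ℝ) (X : Matrix (Fin N) (Fin N) ℝ)
    (L : Matrix (Fin N) (Fin 1) ℝ) (t : ℕ → ℝ) (u : ℕ → ℝ) (y : ℝ → ℝ)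
    (zhat : ℝ → Fin N → ℝ) : Prop where
  continuousOn : ContinuousOn zhat (Ici 0)
  init : zhat 0 = 0
  equation : ∀ k, ∀ s ∈ Ioo (t k) (t (k + 1)),
    HasDerivAt zhat
      ((matA q N + (γ * σ) • X) *ᵥ zhat s + matB N *ᵥ (fun _ => u k)
        - L *ᵥ (matC N *ᵥ zhat s - fun _ => y s)) s

/-- The closed loop: the heat equation with output `y(t) = z(0, t)` and zero-order-hold input
`u(t_k) = -K zhat(t_k)`, together with the observer. -/
structure IsClosedLoopSolution {N : ℕ} (q σ γ : ℝ) (X : Matrix (Fin N) (Fin N) ℝ)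
    (K : Matrix (Fin 1) (Fin N) ℝ) (L : Matrix (Fin N) (Fin 1) ℝ)
    (f : ℝ → L2 → L2) (t : ℕ → ℝ)
    (z : ℝ → L2) (y : ℝ → ℝ) (zhat : ℝ → Fin N → ℝ) : Prop where
  plant : IsPlantSolution q f t (fun k => -(K *ᵥ zhat (t k)) 0) z
  output : ∀ s, 0 < s → HasPointValue (z s) 0 (y s)
  observer : IsObserverSolution q σ γ X L t (fun k => -(K *ᵥ zhat (t k)) 0) y zhat

/-- The square `|e^N|²` of the Euclidean norm of the estimation error `e^N = zhat - z^N`. -/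
def errorSq {N : ℕ} (w : L2) (what : Fin N → ℝ) : ℝ :=
  ∑ n : Fin N, (what n - fourierMode w n) ^ 2

end HeatControl

end

open HeatControl

namespace HeatControl

/-! ### Completeness of the cosines -/

/-! The proof is a Lyapunov argument after modal truncation. In the Neumann basis the first `N`
modes satisfy `z^N' = A z^N + B u + F`, where `F` collects the first `N` modes of `f`. The
functional is `V = z^N·Pz z^N + e·Pe e + (1/γ)‖residue‖²`, the residue being the part of `z` in the
modes `n ≥ N`.

Three estimates are combined. The residue, seen as a system from the input `u` to the output `ζ = y
- C z^N`, dissipates: the derivative of `(1/γ)‖residue‖²` is at most `u² - γ⁻² ζ²` up to terms in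
`f` and `z` (`residue_dissipation`). This rests on expanding the point value `y` in the cosine
series and on `∑_{n ≥ N} φ_n(0)² / (λ_n - q - σ) = γ`. The Lipschitz bound `‖f‖ ≤ σ‖z‖` removes the
high modes from those terms, leaving `(σ/γ)|z^N|² - |F|²/(γσ)`. What remains is a quadratic form in
finitely many variables, to which `Ψ ≤ 0` applies (`closedLoop_dissipation`). The result is `V' ≤
(π²/4) Q - h² D`, where `Q` is the weighted square of the sampling errors of `z^N` and `e`, and `D`
that of their rates of change.

On each sampling interval a Wirtinger argument absorbs `Q`, which vanishes at the sampling instant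
(`le_left_of_deriv_le_sampling`). So `V` never exceeds its value at the preceding sampling instant,
hence `V(t) ≤ V(0)`. Since `V` dominates `‖z‖² + |e^N|²`, and `zhat(0) = 0` bounds `V(0)` by a
multiple of `‖z(0)‖²`, stability follows.

The analytic preliminaries supply completeness of the cosines and the Fourier coefficients of `z_xx`
with their boundary term. -/

theorem integral_mul_cos_pow_mul_cos_eq_zero {w : ℝ → ℝ} (hw : IntegrableOn w (Ioo 0 Real.pi))
    (h : ∀ n : ℕ, ∫ x in Ioo 0 Real.pi, w x * Real.cos (n * x) = 0) (k : ℕ) :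
    ∀ n : ℕ, ∫ x in Ioo 0 Real.pi, w x * (Real.cos x ^ k * Real.cos (n * x)) = 0 := by
  have hint : ∀ (k n : ℕ), IntegrableOn (fun x => w x * (Real.cos x ^ k * Real.cos (n * x)))
      (Ioo 0 Real.pi) := by
    intro k n
    refine Integrable.mul_bdd (c := 1) hw (by fun_prop) (ae_of_all _ fun x => ?_)
    rw [norm_mul, norm_pow]
    exact mul_le_one₀ (pow_le_one₀ (norm_nonneg _) (Real.abs_cos_le_one _)) (norm_nonneg _)
      (Real.abs_cos_le_one _)
  induction k with
  | zero => simpa using h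
  | succ k ih =>
    intro n
    rcases n with _ | n
    · have := ih 1
      simpa [pow_succ] using this
    · have h1 := ih n
      have h2 := ih (n + 2)
      -- Product-to-sum: `2 cos x cos((n+1)x) = cos(nx) + cos((n+2)x)` trades one power of the
      -- cosine for two neighbouring frequencies.
      have key : ∀ x, w x * (Real.cos x ^ (k + 1) * Real.cos ((n + 1 : ℕ) * x))
          = (1 / 2) * (w x * (Real.cos x ^ k * Real.cos (n * x))
            + w x * (Real.cos x ^ k * Real.cos ((n + 2 : ℕ) * x))) := by
        intro x
        have e1 : (n : ℝ) * x = ((n + 1 : ℕ) : ℝ) * x - x := by push_cast; ring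
        have e2 : ((n + 2 : ℕ) : ℝ) * x = ((n + 1 : ℕ) : ℝ) * x + x := by push_cast; ring
        rw [e1, e2, Real.cos_sub, Real.cos_add]
        ring
      simp_rw [key]
      rw [integral_const_mul, integral_add (hint k n) (hint k (n + 2)), h1, h2]
      simp

/-- Since `cos` is injective on `[0, π]`, a continuous `g` there is a continuous function of `cos
x`, namely `g ∘ arccos`. Weierstrass approximates it uniformly by polynomials in `cos x`, against
which `w` integrates to zero. -/
theorem integral_mul_eq_zero_of_cos {w : ℝ → ℝ} (hw : IntegrableOn w (Ioo 0 Real.pi))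
    (h : ∀ n : ℕ, ∫ x in Ioo 0 Real.pi, w x * Real.cos (n * x) = 0) {g : ℝ → ℝ}
    (hg : Continuous g) : ∫ x in Ioo 0 Real.pi, w x * g x = 0 := by
  have hbdd : ∀ {G : ℝ → ℝ}, Continuous G →
      IntegrableOn (fun x => w x * G x) (Ioo 0 Real.pi) := by
    intro G hG
    obtain ⟨M, hM⟩ := (isCompact_Icc (a := (0 : ℝ)) (b := Real.pi)).exists_bound_of_continuousOn
      hG.continuousOn
    refine Integrable.mul_bdd (c := M) hw hG.aestronglyMeasurable ?_
    filter_upwards [ae_restrict_mem measurableSet_Ioo] with x hx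
    exact hM x (Ioo_subset_Icc_self hx)
  have hpoly : ∀ p : Polynomial ℝ, ∫ x in Ioo 0 Real.pi, w x * p.eval (Real.cos x) = 0 := by
    intro p
    induction p using Polynomial.induction_on' with
    | add p r hp hr =>
      simp only [Polynomial.eval_add, mul_add]
      have hp' : Continuous fun x => p.eval (Real.cos x) := p.continuous.comp Real.continuous_cos
      have hr' : Continuous fun x => r.eval (Real.cos x) := r.continuous.comp Real.continuous_cos
      rw [integral_add (hbdd hp') (hbdd hr'), hp, hr, add_zero]
    | monomial k a =>
      have := integral_mul_cos_pow_mul_cos_eq_zero hw h k 0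
      simp only [Nat.cast_zero, zero_mul, Real.cos_zero, mul_one] at this
      have e : ∀ x, w x * (Polynomial.monomial k a).eval (Real.cos x)
          = a * (w x * Real.cos x ^ k) := by
        intro x; rw [Polynomial.eval_monomial]; ring
      simp_rw [e]
      rw [integral_const_mul, this, mul_zero]
  set I := ∫ x in Ioo 0 Real.pi, |w x| with hI
  have hI0 : 0 ≤ I := integral_nonneg fun x => abs_nonneg _
  refine abs_nonpos_iff.1 (le_of_forall_pos_le_add fun ε hε => ?_)
  -- The tolerance is divided by `I + 1` rather than `I`, which may vanish.
  obtain ⟨p, hp⟩ := exists_polynomial_near_of_continuousOn (-1) 1 (fun s => g (Real.arccos s))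
    (hg.comp Real.continuous_arccos).continuousOn (ε / (I + 1)) (by positivity)
  have hpc : Continuous fun x => p.eval (Real.cos x) := p.continuous.comp Real.continuous_cos
  have e : ∫ x in Ioo 0 Real.pi, w x * g x
      = ∫ x in Ioo 0 Real.pi, w x * (g x - p.eval (Real.cos x)) := by
    simp only [mul_sub]
    rw [integral_sub (hbdd hg) (hbdd hpc), hpoly p, sub_zero]
  rw [e, zero_add]
  calc |∫ x in Ioo 0 Real.pi, w x * (g x - p.eval (Real.cos x))|
      ≤ ∫ x in Ioo 0 Real.pi, |w x| * (ε / (I + 1)) := by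
        rw [← Real.norm_eq_abs]
        refine norm_integral_le_of_norm_le (hw.abs.mul_const _) ?_
        filter_upwards [ae_restrict_mem measurableSet_Ioo] with x hx
        rw [norm_mul]
        refine mul_le_mul_of_nonneg_left ?_ (abs_nonneg _)
        have := hp (Real.cos x) ⟨Real.neg_one_le_cos x, Real.cos_le_one x⟩
        rw [Real.arccos_cos hx.1.le hx.2.le] at this
        rw [Real.norm_eq_abs, abs_sub_comm]
        exact this.le
    _ = I / (I + 1) * ε := by rw [integral_mul_const, ← hI]; ring
    _ ≤ 1 * ε := by
        refine mul_le_mul_of_nonneg_right ?_ hε.le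
        rw [div_le_one (by positivity)]; linarith
    _ = ε := one_mul ε

theorem ae_eq_zero_of_integral_mul_cos {w : ℝ → ℝ} (hw : IntegrableOn w (Ioo 0 Real.pi))
    (h : ∀ n : ℕ, ∫ x in Ioo 0 Real.pi, w x * Real.cos (n * x) = 0) :
    w =ᵐ[volume.restrict (Ioo (0 : ℝ) Real.pi)] 0 := by
  have := isOpen_Ioo.ae_eq_zero_of_integral_contDiff_smul_eq_zero (U := Ioo (0 : ℝ) Real.pi)
    (μ := volume) hw.locallyIntegrableOn (by
      intro g hg _ hs
      have h0 := integral_mul_eq_zero_of_cos hw h hg.continuous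
      rw [← h0, eq_comm]
      rw [setIntegral_eq_integral_of_forall_compl_eq_zero]
      · exact integral_congr_ae (ae_of_all _ fun x => mul_comm _ _)
      · intro x hx
        rw [image_eq_zero_of_notMem_tsupport fun hx' => hx (hs hx'), mul_zero])
  rw [Filter.EventuallyEq, ae_restrict_iff' measurableSet_Ioo]
  exact this

/-! ### Integration by parts up to the boundary -/

-- The kernels are nonnegative, have mass one and live on `[ε, 2ε]`, so they form a one-sided
-- approximate identity at `0`. They arise as derivatives of the cutoff near the boundary.
open Real (smoothTransition) in
theorem tendsto_integral_mul_deriv_smoothTransition {F : ℝ → ℝ}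
    (hF : ContinuousOn F (Icc 0 Real.pi)) :
    Tendsto (fun ε : ℝ => ∫ x in Ioo 0 Real.pi,
      F x * (deriv smoothTransition (x / ε - 1) / ε)) (𝓝[>] 0) (𝓝 (F 0)) := by
  have hS : ContDiff ℝ 1 smoothTransition := Real.smoothTransition.contDiff
  have hS' : Continuous (deriv smoothTransition) := hS.continuous_deriv le_rfl
  have hsmall : ∀ r : ℝ, 0 < r → ∀ᶠ ε : ℝ in 𝓝[>] 0, 0 < ε ∧ 2 * ε < r := by
    intro r hr
    filter_upwards [Ioo_mem_nhdsGT (show (0 : ℝ) < r / 2 by positivity)] with ε hε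
    exact ⟨hε.1, by linarith [hε.2]⟩
  have hzero : ∀ s : ℝ, 1 < s → deriv smoothTransition s = 0 := by
    intro s hs
    have : smoothTransition =ᶠ[𝓝 s] fun _ => 1 := by
      filter_upwards [Ioi_mem_nhds hs] with y hy
      exact Real.smoothTransition.one_of_one_le (le_of_lt hy)
    rw [this.deriv_eq, deriv_const]
  have := tendsto_setIntegral_peak_smul_of_integrableOn_of_tendsto (μ := volume)
    (s := Ioo (0 : ℝ) Real.pi) (t := Ioo (0 : ℝ) Real.pi) (x₀ := (0 : ℝ)) (l := 𝓝[>] (0 : ℝ))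
    (φ := fun ε x => deriv smoothTransition (x / ε - 1) / ε) (g := F) (a := F 0)
    measurableSet_Ioo measurableSet_Ioo subset_rfl self_mem_nhdsWithin ?_ ?_ ?_ ?_ ?_ ?_ ?_
  · simpa [mul_comm] using this
  · simp
  · filter_upwards [self_mem_nhdsWithin] with ε hε x _
    exact div_nonneg Real.smoothTransition.monotone.deriv_nonneg (le_of_lt hε)
  · intro u hu h0
    obtain ⟨r, hr, hru⟩ := Metric.isOpen_iff.1 hu 0 h0
    rw [Metric.tendstoUniformlyOn_iff]
    intro η hη
    filter_upwards [hsmall r hr] with ε hε x hx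
    have hxr : r ≤ x := by
      by_contra hlt
      exact hx.2 (hru (by rw [Metric.mem_ball, Real.dist_eq, sub_zero, abs_of_pos hx.1.1]
                          exact not_le.1 hlt))
    rw [hzero, zero_div]
    · simpa using hη
    · rw [lt_sub_iff_add_lt, lt_div_iff₀ hε.1]; linarith [hε.2]
  · refine tendsto_const_nhds.congr' ?_
    filter_upwards [hsmall Real.pi Real.pi_pos] with ε hε
    rw [← integral_Ioc_eq_integral_Ioo, ← intervalIntegral.integral_of_le Real.pi_pos.le,
      intervalIntegral.integral_eq_sub_of_hasDerivAt
        (f := fun x => smoothTransition (x / ε - 1))]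
    · rw [Real.smoothTransition.one_of_one_le, Real.smoothTransition.zero_of_nonpos]
      · simp
      · simp
      · rw [le_sub_iff_add_le, le_div_iff₀ hε.1]; linarith [hε.2]
    · intro x _
      have h1 := (hS.differentiable one_ne_zero (x / ε - 1)).hasDerivAt
      have h2 : HasDerivAt (fun x : ℝ => x / ε - 1) (1 / ε) x :=
        ((hasDerivAt_id x).div_const ε).sub_const 1
      simpa [div_eq_mul_inv, Function.comp_def] using h1.comp x h2
    · exact Continuous.intervalIntegrable (by fun_prop) _ _
  · exact Eventually.of_forall fun ε => Continuous.aestronglyMeasurable (by fun_prop)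
  · exact (hF.integrableOn_Icc).mono_set Ioo_subset_Icc_self
  · exact ((hF 0 ⟨le_rfl, Real.pi_pos.le⟩).mono Ioo_subset_Icc_self)


theorem L2.integrable_mul_of_continuous (g : L2) {φ : ℝ → ℝ} (hφ : Continuous φ) :
    IntegrableOn (fun x => g x * φ x) (Ioo 0 Real.pi) := by
  obtain ⟨M, hM⟩ := (isCompact_Icc (a := (0 : ℝ)) (b := Real.pi)).exists_bound_of_continuousOn
    hφ.continuousOn
  refine Integrable.mul_bdd (c := M) ((Lp.memLp g).integrable (by norm_num))
    hφ.aestronglyMeasurable ?_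
  filter_upwards [ae_restrict_mem measurableSet_Ioo] with x hx
  exact hM x (Ioo_subset_Icc_self hx)

/-- A smooth cutoff, equal to `1` on `[2ε, π - 2ε]` and to `0` outside `[ε, π - ε]`. -/
noncomputable def cutoff (ε x : ℝ) : ℝ :=
  Real.smoothTransition (x / ε - 1) + Real.smoothTransition ((Real.pi - x) / ε - 1) - 1

theorem contDiff_cutoff (ε : ℝ) : ContDiff ℝ ∞ (cutoff ε) := by
  unfold cutoff
  refine ((Real.smoothTransition.contDiff.comp ?_).add
    (Real.smoothTransition.contDiff.comp ?_)).sub contDiff_const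
  · exact (contDiff_id.div_const _).sub contDiff_const
  · exact ((contDiff_const.sub contDiff_id).div_const _).sub contDiff_const

theorem hasDerivAt_cutoff (ε x : ℝ) :
    HasDerivAt (cutoff ε) (deriv Real.smoothTransition (x / ε - 1) / ε
      - deriv Real.smoothTransition ((Real.pi - x) / ε - 1) / ε) x := by
  have hS : Differentiable ℝ Real.smoothTransition :=
    (Real.smoothTransition.contDiff (n := 1)).differentiable one_ne_zero
  have h1 : HasDerivAt (fun x : ℝ => x / ε - 1) (1 / ε) x :=
    ((hasDerivAt_id x).div_const ε).sub_const 1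
  have h2 : HasDerivAt (fun x : ℝ => (Real.pi - x) / ε - 1) (-1 / ε) x :=
    (((hasDerivAt_id x).const_sub Real.pi).div_const ε).sub_const 1
  have h3 := (((hS (x / ε - 1)).hasDerivAt.comp x h1).add
    ((hS ((Real.pi - x) / ε - 1)).hasDerivAt.comp x h2)).sub_const 1
  convert! h3 using 1
  ring

theorem abs_cutoff_le_one (ε x : ℝ) : |cutoff ε x| ≤ 1 := by
  unfold cutoff
  have h1 := Real.smoothTransition.nonneg (x / ε - 1)
  have h2 := Real.smoothTransition.le_one (x / ε - 1)
  have h3 := Real.smoothTransition.nonneg ((Real.pi - x) / ε - 1)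
  have h4 := Real.smoothTransition.le_one ((Real.pi - x) / ε - 1)
  rw [abs_le]
  constructor <;> linarith

theorem cutoff_eq_one {ε x : ℝ} (hε : 0 < ε) (h0 : 2 * ε ≤ x) (h1 : 2 * ε ≤ Real.pi - x) :
    cutoff ε x = 1 := by
  unfold cutoff
  rw [Real.smoothTransition.one_of_one_le, Real.smoothTransition.one_of_one_le]
  · norm_num
  · rw [le_sub_iff_add_le, le_div_iff₀ hε]; linarith
  · rw [le_sub_iff_add_le, le_div_iff₀ hε]; linarith

theorem tsupport_cutoff_subset {ε : ℝ} (hε : 0 < ε) (h : 3 * ε ≤ Real.pi) :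
    tsupport (cutoff ε) ⊆ Icc ε (Real.pi - ε) := by
  refine closure_minimal (fun x hx => ?_) isClosed_Icc
  by_contra hx'
  refine hx ?_
  rw [mem_Icc, not_and_or, not_le, not_le] at hx'
  unfold cutoff
  rcases hx' with h0 | h0
  · rw [Real.smoothTransition.zero_of_nonpos, Real.smoothTransition.one_of_one_le]
    · norm_num
    · rw [le_sub_iff_add_le, le_div_iff₀ hε]; linarith
    · rw [sub_nonpos, div_le_one hε]; exact h0.le
  · rw [Real.smoothTransition.one_of_one_le, Real.smoothTransition.zero_of_nonpos]
    · norm_num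
    · rw [sub_nonpos, div_le_one hε]; linarith
    · rw [le_sub_iff_add_le, le_div_iff₀ hε]; linarith

theorem tendsto_integral_mul_cutoff {G : ℝ → ℝ} (hG : IntegrableOn G (Ioo 0 Real.pi)) :
    Tendsto (fun ε : ℝ => ∫ x in Ioo 0 Real.pi, G x * cutoff ε x) (𝓝[>] 0)
      (𝓝 (∫ x in Ioo 0 Real.pi, G x)) := by
  refine tendsto_integral_filter_of_dominated_convergence (fun x => |G x|) ?_ ?_ hG.abs ?_
  · exact Eventually.of_forall fun ε =>
      hG.aestronglyMeasurable.mul (contDiff_cutoff ε).continuous.aestronglyMeasurable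
  · refine Eventually.of_forall fun ε => ae_of_all _ fun x => ?_
    rw [norm_mul]
    exact mul_le_of_le_one_right (abs_nonneg _) (abs_cutoff_le_one ε x)
  · filter_upwards [ae_restrict_mem measurableSet_Ioo] with x hx
    refine tendsto_const_nhds.congr' ?_
    have hm : 0 < min x (Real.pi - x) / 2 := half_pos (lt_min hx.1 (sub_pos.2 hx.2))
    filter_upwards [Ioo_mem_nhdsGT hm] with ε hε
    rw [cutoff_eq_one hε.1, mul_one]
    · linarith [hε.2, min_le_left x (Real.pi - x)]
    · linarith [hε.2, min_le_right x (Real.pi - x)]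

/-- The weak derivative only sees test functions supported inside the interval. Testing with `φ`
times the cutoff and letting `ε → 0`, the derivative of the cutoff concentrates at both ends and
produces the boundary terms. -/
theorem HasWeakDeriv.integral_mul_of_continuousOn {g g' : L2} (h : HasWeakDeriv g g')
    {c : ℝ → ℝ} (hc : ContinuousOn c (Icc 0 Real.pi))
    (hgc : (g : ℝ → ℝ) =ᵐ[volume.restrict (Ioo (0 : ℝ) Real.pi)] c)
    {φ : ℝ → ℝ} (hφ : ContDiff ℝ ∞ φ) :
    ∫ x in Ioo 0 Real.pi, g' x * φ x
      = c Real.pi * φ Real.pi - c 0 * φ 0 - ∫ x in Ioo 0 Real.pi, g x * deriv φ x := by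
  have hφ' : Continuous (deriv φ) := hφ.continuous_deriv (by simp)
  set a : ℝ → ℝ → ℝ := fun ε x => deriv Real.smoothTransition (x / ε - 1) / ε with ha
  have hac : ∀ ε, Continuous (a ε) := by
    intro ε
    have hS' : Continuous (deriv Real.smoothTransition) :=
      (Real.smoothTransition.contDiff (n := 1)).continuous_deriv le_rfl
    simp only [ha]
    fun_prop
  set F : ℝ → ℝ := fun x => c x * φ x with hF
  have hFc : ContinuousOn F (Icc 0 Real.pi) := hc.mul hφ.continuous.continuousOn
  have hFr : ContinuousOn (fun x => F (Real.pi - x)) (Icc 0 Real.pi) := by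
    refine hFc.comp (by fun_prop) fun x hx => ⟨?_, ?_⟩
    · linarith [hx.2]
    · linarith [hx.1]
  have t1 := tendsto_integral_mul_cutoff (g'.integrable_mul_of_continuous hφ.continuous)
  have t2 := tendsto_integral_mul_cutoff (g.integrable_mul_of_continuous hφ')
  have t3 := tendsto_integral_mul_deriv_smoothTransition hFc
  have t4 := tendsto_integral_mul_deriv_smoothTransition hFr
  have key : ∀ᶠ ε : ℝ in 𝓝[>] 0, ∫ x in Ioo 0 Real.pi, g' x * φ x * cutoff ε x
      = -((∫ x in Ioo 0 Real.pi, g x * deriv φ x * cutoff ε x)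
        + ((∫ x in Ioo 0 Real.pi, F x * a ε x)
          - ∫ x in Ioo 0 Real.pi, F (Real.pi - x) * a ε x)) := by
    filter_upwards [Ioo_mem_nhdsGT (show (0 : ℝ) < Real.pi / 3 by positivity)] with ε hε
    have hsup := tsupport_cutoff_subset hε.1 (by linarith [hε.2])
    have hsub : tsupport (fun x => φ x * cutoff ε x) ⊆ Icc ε (Real.pi - ε) :=
      (tsupport_mul_subset_right (f := φ) (g := cutoff ε)).trans hsup
    have hw := h (fun x => φ x * cutoff ε x) (hφ.mul (contDiff_cutoff ε))
      (isCompact_Icc.of_isClosed_subset (isClosed_tsupport _) hsub)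
      (hsub.trans (Icc_subset_Ioo hε.1 (by linarith [hε.1])))
    -- Reflecting `x ↦ π - x` moves the peak at `π` to `0`, so one limit lemma serves both ends.
    have hrefl : ∫ x in Ioo 0 Real.pi, F (Real.pi - x) * a ε x
        = ∫ x in Ioo 0 Real.pi, F x * a ε (Real.pi - x) := by
      have := intervalIntegral.integral_comp_sub_left (a := 0) (b := Real.pi)
        (fun x => F x * a ε (Real.pi - x)) Real.pi
      simp only [sub_sub_cancel, sub_self, sub_zero] at this
      rw [← integral_Ioc_eq_integral_Ioo, ← integral_Ioc_eq_integral_Ioo,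
        ← intervalIntegral.integral_of_le Real.pi_pos.le,
        ← intervalIntegral.integral_of_le Real.pi_pos.le, this]
    have hd : ∀ x, deriv (fun x => φ x * cutoff ε x) x
        = deriv φ x * cutoff ε x + φ x * (a ε x - a ε (Real.pi - x)) := fun x =>
      ((hφ.differentiable (by simp) x).hasDerivAt.mul (hasDerivAt_cutoff ε x)).deriv
    have i1 : IntegrableOn (fun x => g x * deriv φ x * cutoff ε x) (Ioo 0 Real.pi) := by
      simpa [mul_assoc] using
        g.integrable_mul_of_continuous (hφ'.mul (contDiff_cutoff ε).continuous)
    have i2 : ∀ {b : ℝ → ℝ}, Continuous b → IntegrableOn (fun x => F x * b x) (Ioo 0 Real.pi) :=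
      fun hb => ((hFc.mul hb.continuousOn).integrableOn_Icc).mono_set Ioo_subset_Icc_self
    have i3 : Continuous fun x => a ε (Real.pi - x) := (hac ε).comp (by fun_prop)
    have i4 : IntegrableOn (fun x => F x * a ε x - F x * a ε (Real.pi - x)) (Ioo 0 Real.pi) :=
      (i2 (hac ε)).sub (i2 i3)
    have hprod : ∫ x in Ioo 0 Real.pi, g x * deriv (fun x => φ x * cutoff ε x) x
        = (∫ x in Ioo 0 Real.pi, g x * deriv φ x * cutoff ε x)
          + ((∫ x in Ioo 0 Real.pi, F x * a ε x)
            - ∫ x in Ioo 0 Real.pi, F x * a ε (Real.pi - x)) := by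
      rw [← integral_sub (i2 (hac ε)) (i2 i3), ← integral_add i1 i4]
      refine integral_congr_ae ?_
      filter_upwards [hgc] with x hx
      simp only [hd, hF, ← hx]
      ring
    rw [hrefl, ← hprod, hw, neg_neg]
    simp only [mul_assoc]
  have hlim := tendsto_nhds_unique (t1.congr' key) ((t2.add (t3.sub t4)).neg)
  rw [hlim]
  simp only [hF, sub_zero]
  ring

theorem HasPointValue.eq_of_continuousOn {g : L2} {x v : ℝ} (h : HasPointValue g x v)
    (hx : x ∈ Icc 0 Real.pi) {c : ℝ → ℝ} (hc : ContinuousOn c (Icc 0 Real.pi))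
    (hgc : (g : ℝ → ℝ) =ᵐ[volume.restrict (Ioo (0 : ℝ) Real.pi)] c) : c x = v := by
  obtain ⟨d, hd, hgd, rfl⟩ := h
  refine Measure.eqOn_Icc_of_ae_eq volume Real.pi_pos.ne ?_ hc hd hx
  rw [← restrict_Ioo_eq_restrict_Icc]
  exact hgc.symm.trans hgd

/-! ### The orthonormal basis of Neumann eigenfunctions -/

theorem eigfun_eq (n : ℕ) (x : ℝ) :
    eigfun n x = (if n = 0 then 1 / √Real.pi else √(2 / Real.pi)) * Real.cos (n * x) := by
  unfold eigfun
  split_ifs with h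
  · simp [h]
  · rfl

theorem contDiff_eigfun (n : ℕ) : ContDiff ℝ ∞ (eigfun n) := by
  have : eigfun n = fun x => (if n = 0 then 1 / √Real.pi else √(2 / Real.pi)) * Real.cos (n * x) :=
    funext (eigfun_eq n)
  rw [this]
  fun_prop

theorem sqrt_two_div_pi_le_one : √(2 / Real.pi) ≤ 1 := by
  rw [Real.sqrt_le_one]
  rw [div_le_one Real.pi_pos]
  exact Real.two_le_pi

theorem abs_eigfun_le_one (n : ℕ) (x : ℝ) : |eigfun n x| ≤ 1 := by
  rw [eigfun_eq, abs_mul]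
  refine mul_le_one₀ ?_ (abs_nonneg _) (Real.abs_cos_le_one _)
  split_ifs
  · rw [abs_of_nonneg (by positivity), div_le_one (by positivity), Real.one_le_sqrt]
    linarith [Real.two_le_pi]
  · rw [abs_of_nonneg (by positivity)]
    exact sqrt_two_div_pi_le_one

theorem eigfun_zero_sq {n : ℕ} (hn : n ≠ 0) : eigfun n 0 ^ 2 = 2 / Real.pi := by
  rw [eigfun, if_neg hn, mul_zero, Real.cos_zero, mul_one, Real.sq_sqrt (by positivity)]

theorem eigfun_pi_sq {n : ℕ} (hn : n ≠ 0) : eigfun n Real.pi ^ 2 = 2 / Real.pi := by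
  rw [eigfun, if_neg hn, Real.cos_nat_mul_pi, mul_pow, ← pow_mul, mul_comm n 2, pow_mul,
    Real.sq_sqrt (by positivity)]
  simp

theorem hasDerivAt_eigfun (n : ℕ) (x : ℝ) :
    HasDerivAt (eigfun n) (-(n * (if n = 0 then 1 / √Real.pi else √(2 / Real.pi)))
      * Real.sin (n * x)) x := by
  have : eigfun n = fun x => (if n = 0 then 1 / √Real.pi else √(2 / Real.pi)) * Real.cos (n * x) :=
    funext (eigfun_eq n)
  rw [this]
  have h1 : HasDerivAt (fun x : ℝ => (n : ℝ) * x) n x := by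
    simpa using (hasDerivAt_id x).const_mul (n : ℝ)
  convert! h1.cos.const_mul (if n = 0 then 1 / √Real.pi else √(2 / Real.pi)) using 1
  ring

theorem deriv_eigfun (n : ℕ) :
    deriv (eigfun n) = fun x => -(n * (if n = 0 then 1 / √Real.pi else √(2 / Real.pi)))
      * Real.sin (n * x) :=
  funext fun x => (hasDerivAt_eigfun n x).deriv

theorem deriv_deriv_eigfun (n : ℕ) (x : ℝ) :
    deriv (deriv (eigfun n)) x = -eigval n * eigfun n x := by
  rw [deriv_eigfun]
  have h1 : HasDerivAt (fun x : ℝ => (n : ℝ) * x) n x := by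
    simpa using (hasDerivAt_id x).const_mul (n : ℝ)
  rw [(h1.sin.const_mul _).deriv, eigfun_eq, eigval]
  ring

theorem integral_cos_nat_mul {k : ℤ} (hk : k ≠ 0) :
    ∫ x in Ioo 0 Real.pi, Real.cos (k * x) = 0 := by
  have hk' : (k : ℝ) ≠ 0 := by exact_mod_cast hk
  rw [← integral_Ioc_eq_integral_Ioo, ← intervalIntegral.integral_of_le Real.pi_pos.le,
    intervalIntegral.integral_eq_sub_of_hasDerivAt (f := fun x => Real.sin (k * x) / k)]
  · simp [Real.sin_int_mul_pi]
  · intro x _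
    have h1 : HasDerivAt (fun x : ℝ => (k : ℝ) * x) k x := by
      simpa using (hasDerivAt_id x).const_mul (k : ℝ)
    convert! h1.sin.div_const (k : ℝ) using 1
    field_simp
  · exact Continuous.intervalIntegrable (by fun_prop) _ _

theorem integral_cos_mul_cos (m n : ℕ) :
    ∫ x in Ioo 0 Real.pi, Real.cos (m * x) * Real.cos (n * x)
      = if m = n then (if n = 0 then Real.pi else Real.pi / 2) else 0 := by
  have hint : ∀ k : ℤ, IntegrableOn (fun x : ℝ => Real.cos (k * x)) (Ioo 0 Real.pi) := fun k =>
    (Continuous.integrableOn_Icc (by fun_prop)).mono_set Ioo_subset_Icc_self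
  have e : ∀ x : ℝ, Real.cos (m * x) * Real.cos (n * x)
      = 1 / 2 * (Real.cos (((m + n : ℤ) : ℝ) * x) + Real.cos (((m - n : ℤ) : ℝ) * x)) := by
    intro x
    push_cast
    rw [add_mul, sub_mul, Real.cos_add, Real.cos_sub]
    ring
  simp_rw [e]
  rw [integral_const_mul, integral_add (hint _) (hint _)]
  split_ifs with h1 h2
  · subst h1; subst h2
    simp [Real.pi_pos.le]
    ring
  · subst h1
    rw [integral_cos_nat_mul (by omega)]
    simp [Real.pi_pos.le]
    ring
  · rw [integral_cos_nat_mul (by omega), integral_cos_nat_mul (by omega)]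
    simp

theorem memLp_eigfun (n : ℕ) : MemLp (eigfun n) 2 (volume.restrict (Ioo (0 : ℝ) Real.pi)) :=
  MemLp.of_bound (contDiff_eigfun n).continuous.aestronglyMeasurable 1
    (ae_of_all _ (abs_eigfun_le_one n))

/-- The `n`-th eigenfunction as an element of `L²(0, π)`. -/
noncomputable def eigvec (n : ℕ) : L2 := (memLp_eigfun n).toLp

theorem inner_eigvec (n : ℕ) (w : L2) : inner ℝ (eigvec n) w = fourierMode w n := by
  rw [L2.inner_def, fourierMode]
  refine integral_congr_ae ?_
  filter_upwards [(memLp_eigfun n).coeFn_toLp] with x hx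
  simp [eigvec, hx]

theorem orthonormal_eigvec : Orthonormal ℝ eigvec := by
  rw [orthonormal_iff_ite]
  intro m n
  rw [inner_eigvec, fourierMode]
  have : ∫ x in Ioo 0 Real.pi, eigvec n x * eigfun m x
      = ∫ x in Ioo 0 Real.pi, ((if n = 0 then 1 / √Real.pi else √(2 / Real.pi))
        * (if m = 0 then 1 / √Real.pi else √(2 / Real.pi)))
        * (Real.cos (m * x) * Real.cos (n * x)) := by
    refine integral_congr_ae ?_
    filter_upwards [(memLp_eigfun n).coeFn_toLp] with x hx
    rw [eigvec, hx, eigfun_eq n, eigfun_eq m]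
    ring
  rw [this, integral_const_mul, integral_cos_mul_cos]
  by_cases hmn : m = n
  · subst hmn
    by_cases hm : m = 0
    · simp only [hm, if_true]
      rw [div_mul_div_comm, Real.mul_self_sqrt Real.pi_pos.le]
      field_simp
    · simp only [hm, if_true, if_false]
      rw [Real.mul_self_sqrt (by positivity)]
      field_simp
  · simp [hmn]

theorem fourierMode_eq_zero {w : L2} (h : ∀ n, fourierMode w n = 0) : w = 0 := by
  rw [Lp.eq_zero_iff_ae_eq_zero]
  refine ae_eq_zero_of_integral_mul_cos ((Lp.memLp w).integrable (by norm_num)) fun n => ?_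
  have := h n
  unfold fourierMode at this
  have e : ∀ x, w x * eigfun n x = (if n = 0 then 1 / √Real.pi else √(2 / Real.pi))
      * (w x * Real.cos (n * x)) := by
    intro x; rw [eigfun_eq]; ring
  simp_rw [e] at this
  rw [integral_const_mul] at this
  refine (mul_eq_zero.1 this).resolve_left ?_
  split_ifs <;> positivity

/-- The Hilbert basis of Neumann eigenfunctions. -/
noncomputable def eigbasis : HilbertBasis ℕ ℝ L2 :=
  HilbertBasis.mkOfOrthogonalEqBot orthonormal_eigvec (by
    rw [Submodule.eq_bot_iff]
    intro w hw
    refine fourierMode_eq_zero fun n => ?_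
    rw [← inner_eigvec]
    exact hw _ (Submodule.subset_span ⟨n, rfl⟩))

theorem inner_eigbasis (n : ℕ) (w : L2) : inner ℝ (eigbasis n) w = fourierMode w n := by
  rw [eigbasis, HilbertBasis.coe_mkOfOrthogonalEqBot, inner_eigvec]

theorem hasSum_fourierMode_mul (v w : L2) :
    HasSum (fun n => fourierMode v n * fourierMode w n) (inner ℝ v w) := by
  have := eigbasis.hasSum_inner_mul_inner v w
  simpa only [real_inner_comm _ v, inner_eigbasis] using this

theorem hasSum_fourierMode_sq (w : L2) :
    HasSum (fun n => fourierMode w n ^ 2) (‖w‖ ^ 2) := by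
  rw [← real_inner_self_eq_norm_sq]
  simpa only [sq] using hasSum_fourierMode_mul w w

theorem abs_fourierMode_le (w : L2) (n : ℕ) : |fourierMode w n| ≤ ‖w‖ := by
  refine abs_le_of_sq_le_sq ?_ (norm_nonneg w)
  exact le_hasSum (hasSum_fourierMode_sq w) n fun _ _ => sq_nonneg _

/-- The Fourier coefficient as a continuous linear functional. -/
noncomputable def modeCLM (n : ℕ) : L2 →L[ℝ] ℝ := innerSL ℝ (eigvec n)

theorem modeCLM_apply (n : ℕ) (w : L2) : modeCLM n w = fourierMode w n := inner_eigvec n w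

theorem fourierMode_add (v w : L2) (n : ℕ) :
    fourierMode (v + w) n = fourierMode v n + fourierMode w n := by
  simp only [← modeCLM_apply, map_add]

theorem fourierMode_smul (a : ℝ) (w : L2) (n : ℕ) :
    fourierMode (a • w) n = a * fourierMode w n := by
  simp only [← modeCLM_apply, map_smul, smul_eq_mul]

/-! ### Fourier coefficients of the Laplacian and of the point value at `0` -/

/-- Two integrations by parts. The only surviving boundary term is `φ_n(π) u`, because `φ_n'`
vanishes at both ends and `w_x` vanishes at `0`. -/
theorem fourierMode_weakDeriv_weakDeriv {w wx wxx : L2} (h1 : HasWeakDeriv w wx)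
    (h2 : HasWeakDeriv wx wxx) {y u : ℝ} (hy : HasPointValue w 0 y) (h0 : HasPointValue wx 0 0)
    (hu : HasPointValue wx Real.pi u) (n : ℕ) :
    fourierMode wxx n = eigfun n Real.pi * u - eigval n * fourierMode w n := by
  obtain ⟨c, hc, hwc, -⟩ := hy
  obtain ⟨d, hd, hwd, hdu⟩ := hu
  have hd0 : d 0 = 0 := h0.eq_of_continuousOn ⟨le_rfl, Real.pi_pos.le⟩ hd hwd
  have e2 := h2.integral_mul_of_continuousOn hd hwd (contDiff_eigfun n)
  have hsm : ContDiff ℝ ∞ (deriv (eigfun n)) := by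
    rw [deriv_eigfun]
    fun_prop
  have e1 := h1.integral_mul_of_continuousOn hc hwc hsm
  have z0 : deriv (eigfun n) 0 = 0 := by simp [deriv_eigfun]
  have zp : deriv (eigfun n) Real.pi = 0 := by simp [deriv_eigfun, Real.sin_nat_mul_pi]
  rw [z0, zp] at e1
  have e3 : ∫ x in Ioo 0 Real.pi, w x * deriv (deriv (eigfun n)) x
      = -eigval n * fourierMode w n := by
    rw [fourierMode, ← integral_const_mul]
    refine integral_congr_ae (ae_of_all _ fun x => ?_)
    simp only [deriv_deriv_eigfun]
    ring
  rw [fourierMode, e2, e1, e3, hd0, hdu]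
  ring

/-- The series converges uniformly to a continuous function with the same Fourier coefficients as
`w`. By completeness it is a continuous representative of `w`, and such a representative is unique
on `[0, π]`. -/
theorem hasSum_fourierMode_mul_eigfun {w : L2} (hs : Summable fun n => |fourierMode w n|)
    {x v : ℝ} (hx : x ∈ Icc 0 Real.pi) (hv : HasPointValue w x v) :
    HasSum (fun n => fourierMode w n * eigfun n x) v := by
  have hbd : ∀ n x, ‖fourierMode w n * eigfun n x‖ ≤ |fourierMode w n| := fun n x => by
    rw [norm_mul]
    exact mul_le_of_le_one_right (abs_nonneg _) (abs_eigfun_le_one n x)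
  have hsx : ∀ x, Summable fun n => fourierMode w n * eigfun n x := fun x =>
    Summable.of_norm_bounded hs fun n => hbd n x
  have hSc : Continuous fun x => ∑' n, fourierMode w n * eigfun n x :=
    continuous_tsum (fun n => continuous_const.mul (contDiff_eigfun n).continuous) hs hbd
  obtain ⟨B, hB⟩ := (isCompact_Icc (a := (0 : ℝ)) (b := Real.pi)).exists_bound_of_continuousOn
      hSc.continuousOn
  have hSLp : MemLp (fun x => ∑' n, fourierMode w n * eigfun n x) 2
      (volume.restrict (Ioo (0 : ℝ) Real.pi)) := by
    refine MemLp.of_bound hSc.aestronglyMeasurable B ?_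
    filter_upwards [ae_restrict_mem measurableSet_Ioo] with x hx
    exact hB x (Ioo_subset_Icc_self hx)
  have hmode : ∀ m, fourierMode hSLp.toLp m = fourierMode w m := by
    intro m
    have e1 : fourierMode hSLp.toLp m
        = ∫ x in Ioo 0 Real.pi, ∑' n, fourierMode w n * eigfun n x * eigfun m x := by
      refine integral_congr_ae ?_
      filter_upwards [hSLp.coeFn_toLp] with x hx
      rw [hx, tsum_mul_right]
    have hnorm : ∀ n x, ‖fourierMode w n * eigfun n x * eigfun m x‖ ≤ |fourierMode w n| :=
      fun n x => by
        rw [norm_mul]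
        exact (mul_le_of_le_one_right (norm_nonneg _) (abs_eigfun_le_one m x)).trans (hbd n x)
    have hint : ∀ n, IntegrableOn (fun x => fourierMode w n * eigfun n x * eigfun m x)
        (Ioo 0 Real.pi) := fun n =>
      (Continuous.integrableOn_Icc ((continuous_const.mul (contDiff_eigfun n).continuous).mul
        (contDiff_eigfun m).continuous)).mono_set Ioo_subset_Icc_self
    have e2 := hasSum_integral_of_summable_integral_norm hint (by
      refine Summable.of_nonneg_of_le (fun n => integral_nonneg fun x => norm_nonneg _)
        (fun n => ?_) (hs.mul_right Real.pi)
      calc ∫ x in Ioo 0 Real.pi, ‖fourierMode w n * eigfun n x * eigfun m x‖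
          ≤ ∫ x in Ioo 0 Real.pi, |fourierMode w n| :=
            integral_mono (hint n).norm (integrable_const _) fun x => hnorm n x
        _ = |fourierMode w n| * Real.pi := by
            simp [Real.pi_pos.le, mul_comm])
    have e3 : ∀ n, ∫ x in Ioo 0 Real.pi, fourierMode w n * eigfun n x * eigfun m x
        = if n = m then fourierMode w n else 0 := by
      intro n
      have h1 : fourierMode (eigvec n) m = if m = n then 1 else 0 := by
        rw [← inner_eigvec]
        exact orthonormal_iff_ite.1 orthonormal_eigvec m n
      have h2 : fourierMode (eigvec n) m = ∫ x in Ioo 0 Real.pi, eigfun n x * eigfun m x := by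
        refine integral_congr_ae ?_
        filter_upwards [(memLp_eigfun n).coeFn_toLp] with x hx
        rw [eigvec, hx]
      simp_rw [mul_assoc]
      rw [integral_const_mul, ← h2, h1]
      by_cases h : m = n
      · simp [h]
      · simp [h, Ne.symm h]
    simp_rw [e3] at e2
    rw [e1]
    have e4 := hasSum_single (f := fun n => if n = m then fourierMode w n else 0) m
      fun n hn => if_neg hn
    rw [if_pos rfl] at e4
    exact e2.unique e4
  have heq : hSLp.toLp = w := by
    rw [← sub_eq_zero]
    refine fourierMode_eq_zero fun n => ?_
    rw [← modeCLM_apply, map_sub, modeCLM_apply, modeCLM_apply, hmode, sub_self]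
  have hae : (w : ℝ → ℝ) =ᵐ[volume.restrict (Ioo (0 : ℝ) Real.pi)]
      fun x => ∑' n, fourierMode w n * eigfun n x := by
    have := hSLp.coeFn_toLp
    rwa [heq] at this
  rw [← hv.eq_of_continuousOn hx hSc.continuousOn hae]
  exact (hsx x).hasSum

/-! ### The `L²` gain of the residue -/

theorem eigval_sub_ge (κ : ℝ) (N n : ℕ) :
    eigval N - κ + (n : ℝ) ^ 2 ≤ eigval (N + n) - κ := by
  unfold eigval
  push_cast
  have : (0 : ℝ) ≤ N * n := by positivity
  nlinarith

theorem eigval_sub_pos {q σ : ℝ} {N : ℕ} (hN : q + σ < eigval N) (n : ℕ) :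
    0 < eigval (N + n) - q - σ := by
  have := eigval_sub_ge (q + σ) N n
  nlinarith [sq_nonneg (n : ℝ)]

theorem summable_gain {q σ : ℝ} {N : ℕ} (hN : q + σ < eigval N) :
    Summable fun n : ℕ => 1 / (eigval (N + n) - q - σ) := by
  rw [← summable_nat_add_iff 1]
  refine Summable.of_nonneg_of_le (fun n => (one_div_pos.2 (eigval_sub_pos hN _)).le)
    (fun n => ?_) ((summable_nat_add_iff 1).2 (Real.summable_one_div_nat_pow.2 one_lt_two))
  refine one_div_le_one_div_of_le (by positivity) ?_
  have := eigval_sub_ge (q + σ) N (n + 1)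
  linarith

theorem gain_pos {q σ : ℝ} {N : ℕ} (hN : q + σ < eigval N) : 0 < gain q σ N :=
  mul_pos (by positivity) ((summable_gain hN).tsum_pos
    (fun n => (one_div_pos.2 (eigval_sub_pos hN n)).le) 0 (one_div_pos.2 (eigval_sub_pos hN 0)))

/-- The identity in `h` bounds `λ_n |⟨w, φ_n⟩|` by `|u| + ‖wxx‖`, so the coefficients decay like
`1/n²`. -/
theorem summable_abs_fourierMode {w wxx : L2} {u : ℝ}
    (h : ∀ n, fourierMode wxx n = eigfun n Real.pi * u - eigval n * fourierMode w n) :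
    Summable fun n => |fourierMode w n| := by
  rw [← summable_nat_add_iff 1]
  refine Summable.of_nonneg_of_le (fun n => abs_nonneg _) (fun n => ?_)
    (((summable_nat_add_iff 1).2 (Real.summable_one_div_nat_pow.2 one_lt_two)).mul_left
      (|u| + ‖wxx‖))
  have hpos : (0 : ℝ) < ((n + 1 : ℕ) : ℝ) ^ 2 := by positivity
  rw [mul_one_div, le_div_iff₀ hpos]
  have e : fourierMode w (n + 1) * ((n + 1 : ℕ) : ℝ) ^ 2
      = eigfun (n + 1) Real.pi * u - fourierMode wxx (n + 1) := by
    rw [h (n + 1), eigval]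
    ring
  calc |fourierMode w (n + 1)| * ((n + 1 : ℕ) : ℝ) ^ 2
      = |eigfun (n + 1) Real.pi * u - fourierMode wxx (n + 1)| := by
        rw [← e, abs_mul, abs_of_pos hpos]
    _ ≤ |eigfun (n + 1) Real.pi * u| + |fourierMode wxx (n + 1)| := abs_sub _ _
    _ ≤ |u| + ‖wxx‖ := by
        refine add_le_add ?_ (abs_fourierMode_le _ _)
        rw [abs_mul]
        exact mul_le_of_le_one_left (abs_nonneg _) (abs_eigfun_le_one _ _)

/-- The dissipation inequality for the modes `n ≥ N`, with input `u` and output the contribution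
of these modes to the point value `y` at `0`. -/
theorem residue_dissipation {q σ γ : ℝ} {N : ℕ} (hq : 0 < q) (hσ : 0 < σ)
    (hN : q + σ < eigval N) (hγ : γ = gain q σ N) {w wxx φ : L2} {y u : ℝ}
    (hxx : ∀ n, fourierMode wxx n = eigfun n Real.pi * u - eigval n * fourierMode w n)
    (hy : HasPointValue w 0 y) :
    2 / γ * (inner ℝ w (wxx + q • w + φ)
        - ∑ n : Fin N, fourierMode w n * fourierMode (wxx + q • w + φ) n)
      + σ / γ * (‖w‖ ^ 2 - ∑ n : Fin N, fourierMode w n ^ 2)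
      - 1 / (γ * σ) * (‖φ‖ ^ 2 - ∑ n : Fin N, fourierMode φ n ^ 2)
      + (γ ^ 2)⁻¹ * (y - ∑ n : Fin N, eigfun n 0 * fourierMode w n) ^ 2 - u ^ 2 ≤ 0 := by
  have hγ0 : 0 < γ := hγ ▸ gain_pos hN
  -- `N = 0` would give `q + σ < λ_0 = 0`. Hence the constant mode is never in the residue, and
  -- `φ_n(0)² = φ_n(π)² = 2/π` for every `n ≥ N`.
  have hN0 : N ≠ 0 := by
    rintro rfl
    simp only [eigval, Nat.cast_zero, ne_eq, OfNat.ofNat_ne_zero, not_false_eq_true,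
      zero_pow] at hN
    linarith
  have hsum := summable_abs_fourierMode hxx
  have hbs : Summable fun n => eigfun n Real.pi * fourierMode w n := by
    refine Summable.of_norm_bounded hsum fun n => ?_
    rw [norm_mul]
    exact mul_le_of_le_one_left (abs_nonneg _) (abs_eigfun_le_one _ _)
  have H1 := (hasSum_nat_add_iff' N).2 (hasSum_fourierMode_mul w (wxx + q • w + φ))
  have H2 := (hasSum_nat_add_iff' N).2 (hasSum_fourierMode_sq w)
  have H3 := (hasSum_nat_add_iff' N).2 (hasSum_fourierMode_sq φ)
  have H4 := (hasSum_nat_add_iff' N).2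
    (hasSum_fourierMode_mul_eigfun hsum ⟨le_rfl, Real.pi_pos.le⟩ hy)
  have H5 := ((summable_nat_add_iff N).2 hbs).hasSum
  have H6 : HasSum (fun n : ℕ => 2 / Real.pi * (1 / (eigval (n + N) - q - σ))) γ := by
    rw [hγ, gain]
    simp_rw [add_comm _ N]
    exact (summable_gain hN).hasSum.mul_left _
  have hζ : y - ∑ n : Fin N, eigfun n 0 * fourierMode w n
      = y - ∑ n ∈ Finset.range N, fourierMode w n * eigfun n 0 := by
    rw [Finset.sum_range]
    simp only [mul_comm]
  rw [hζ]
  rw [Finset.sum_range] at H1 H2 H3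
  set I := inner ℝ w (wxx + q • w + φ)
    - ∑ n : Fin N, fourierMode w n * fourierMode (wxx + q • w + φ) n with hI
  set a := ‖w‖ ^ 2 - ∑ n : Fin N, fourierMode w n ^ 2 with ha
  set b := ‖φ‖ ^ 2 - ∑ n : Fin N, fourierMode φ n ^ 2 with hb
  set ζ := y - ∑ n ∈ Finset.range N, fourierMode w n * eigfun n 0 with hζ'
  set β := ∑' n, eigfun (n + N) Real.pi * fourierMode w (n + N) with hβ
  -- With `μ_n = λ_n - q - σ`, Young's inequality on `2 w_n φ_n` leaves `2 φ_n(π) u w_n - 2 μ_n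
  -- w_n²` mode by mode. One copy of `μ_n w_n²` pays for the output `ζ`, the other for `β = ∑ φ_n(π)
  -- w_n`, by completing squares with the fixed multipliers `ζ/γ` and `β/γ`. These are chosen so
  -- that the series of remainders sums to `γ` times their squares.
  have hle := hasSum_le (fun n => ?_)
    (((H1.mul_left 2).add (H2.mul_left σ)).sub (H3.mul_left (1 / σ)))
    ((((H5.mul_left (2 * (u - β / γ))).sub (H4.mul_left (2 * (ζ / γ)))).add
      (H6.mul_left ((ζ / γ) ^ 2))).add (H6.mul_left ((β / γ) ^ 2)))
  · have e1 : 2 / γ * I + σ / γ * a - 1 / (γ * σ) * b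
        = 1 / γ * (2 * I + σ * a - 1 / σ * b) := by
      field_simp
    -- The summed bound, divided by `γ`, is `2uβ/γ - β²/γ² - ζ²/γ²`; completing the square in `β/γ`
    -- turns it into at most `u² - ζ²/γ²`.
    have e2 : 1 / γ * (2 * (u - β / γ) * β - 2 * (ζ / γ) * ζ + (ζ / γ) ^ 2 * γ + (β / γ) ^ 2 * γ)
        + (γ ^ 2)⁻¹ * ζ ^ 2 - u ^ 2 = -(u - β / γ) ^ 2 := by
      field_simp
      ring
    have e3 := mul_le_mul_of_nonneg_left hle (one_div_pos.2 hγ0).le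
    rw [e1]
    nlinarith [sq_nonneg (u - β / γ)]
  · have hn : n + N ≠ 0 := by omega
    have hμ : 0 < eigval (n + N) - q - σ := by rw [add_comm]; exact eigval_sub_pos hN n
    rw [fourierMode_add, fourierMode_add, fourierMode_smul, hxx]
    have hb := eigfun_pi_sq hn
    have hc := eigfun_zero_sq hn
    have hquad : ∀ s d x : ℝ, d ^ 2 = 2 / Real.pi →
        0 ≤ (eigval (n + N) - q - σ) * x ^ 2 - 2 * s * (d * x)
          + s ^ 2 * (2 / Real.pi * (1 / (eigval (n + N) - q - σ))) := by
      intro s d x hd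
      rw [← hd]
      have : (eigval (n + N) - q - σ) * x ^ 2 - 2 * s * (d * x)
          + s ^ 2 * (d ^ 2 * (1 / (eigval (n + N) - q - σ)))
          = ((eigval (n + N) - q - σ) * x - s * d) ^ 2 / (eigval (n + N) - q - σ) := by
        field_simp
        ring
      rw [this]
      positivity
    have h1 := hquad (ζ / γ) _ (fourierMode w (n + N)) hc
    have h2 := hquad (β / γ) _ (fourierMode w (n + N)) hb
    have h3 : 0 ≤ σ * fourierMode w (n + N) ^ 2
        - 2 * (fourierMode w (n + N) * fourierMode φ (n + N))
        + 1 / σ * fourierMode φ (n + N) ^ 2 := by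
      have : σ * fourierMode w (n + N) ^ 2
        - 2 * (fourierMode w (n + N) * fourierMode φ (n + N))
        + 1 / σ * fourierMode φ (n + N) ^ 2
        = (σ * fourierMode w (n + N) - fourierMode φ (n + N)) ^ 2 / σ := by
        field_simp
        ring
      rw [this]
      positivity
    linarith

/-! ### The quadratic form of the linear matrix inequality -/

open Matrix in
theorem symBlock_quadraticForm {m n : Type*} [Fintype m] [Fintype n] (D : Matrix m m ℝ)
    (R : Matrix m n ℝ) (T : Matrix n n ℝ) (x : m → ℝ) (y : n → ℝ) :
    Sum.elim x y ⬝ᵥ (symBlock D R T *ᵥ Sum.elim x y)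
      = x ⬝ᵥ (D *ᵥ x) + 2 * (x ⬝ᵥ (R *ᵥ y)) + y ⬝ᵥ (T *ᵥ y) := by
  have h : y ⬝ᵥ (Rᵀ *ᵥ x) = x ⬝ᵥ (R *ᵥ y) := by
    rw [mulVec_transpose, dotProduct_comm, dotProduct_mulVec]
  rw [symBlock, fromBlocks_mulVec, sumElim_dotProduct_sumElim]
  simp only [Sum.elim_comp_inl, Sum.elim_comp_inr, dotProduct_add, h]
  ring

-- The form is regrouped so that the right-hand sides of the equations for `z^N` and `e` appear as
-- vectors. Here `w` stands for `F/(γσ)`, and `vz`, `ve` for the sampling errors of `z^N` and `e`.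
open Matrix in
theorem matPsi_quadraticForm {N : ℕ} {σ γ h : ℝ} {A : Matrix (Fin N) (Fin N) ℝ}
    {B : Matrix (Fin N) (Fin 1) ℝ} {C K : Matrix (Fin 1) (Fin N) ℝ} {L : Matrix (Fin N) (Fin 1) ℝ}
    {X Pz Pe Wz We : Matrix (Fin N) (Fin N) ℝ} (hX : Xᵀ = X) (hPz : Pzᵀ = Pz) (hPe : Peᵀ = Pe)
    (z e w vz ve p r : Fin N → ℝ) (ζ : Fin 1 → ℝ) :
    Sum.elim z (Sum.elim e (Sum.elim w (Sum.elim ζ (Sum.elim vz (Sum.elim ve (Sum.elim p r))))))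
      ⬝ᵥ (matPsi σ γ h A B C K L X Pz Pe Wz We *ᵥ
        Sum.elim z (Sum.elim e (Sum.elim w (Sum.elim ζ
          (Sum.elim vz (Sum.elim ve (Sum.elim p r)))))))
    = 2 * (z ⬝ᵥ (Pz *ᵥ (A *ᵥ z - B *ᵥ (K *ᵥ (z + e + vz + ve)) + (γ * σ) • w)))
      + 2 * (e ⬝ᵥ (Pe *ᵥ (A *ᵥ e - L *ᵥ (C *ᵥ e) + (γ * σ) • (X *ᵥ (z + e)) + L *ᵥ ζ
          - (γ * σ) • w)))
      + (K *ᵥ (z + e + vz + ve)) ⬝ᵥ (K *ᵥ (z + e + vz + ve))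
      + σ / γ * (z ⬝ᵥ z) - γ * σ * (w ⬝ᵥ w) - (γ ^ 2)⁻¹ * (ζ ⬝ᵥ ζ)
      - Real.pi ^ 2 / 4 * (vz ⬝ᵥ (Wz *ᵥ vz) + ve ⬝ᵥ (We *ᵥ ve))
      + 2 * h * ((A *ᵥ z - B *ᵥ (K *ᵥ (z + e + vz + ve)) + (γ * σ) • w) ⬝ᵥ (Wz *ᵥ p))
      + 2 * h * ((A *ᵥ e - L *ᵥ (C *ᵥ e) + (γ * σ) • (X *ᵥ (z + e)) + L *ᵥ ζ
          - (γ * σ) • w) ⬝ᵥ (We *ᵥ r))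
      - p ⬝ᵥ (Wz *ᵥ p) - r ⬝ᵥ (We *ᵥ r) := by
  have tr : ∀ {m n : ℕ} (M : Matrix (Fin m) (Fin n) ℝ) (x : Fin n → ℝ) (y : Fin m → ℝ),
      x ⬝ᵥ (Mᵀ *ᵥ y) = (M *ᵥ x) ⬝ᵥ y := fun M x y => by
    rw [mulVec_transpose, dotProduct_comm, dotProduct_comm _ y, dotProduct_mulVec]
  have sX : ∀ x y, x ⬝ᵥ (X *ᵥ y) = (X *ᵥ x) ⬝ᵥ y := fun x y => by
    conv_lhs => rw [← hX]
    exact tr X x y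
  have sPz : ∀ x, x ⬝ᵥ (Pz *ᵥ z) = z ⬝ᵥ (Pz *ᵥ x) := fun x => by
    conv_lhs => rw [← hPz]
    rw [tr, dotProduct_comm]
  have sPe : ∀ x, x ⬝ᵥ (Pe *ᵥ e) = e ⬝ᵥ (Pe *ᵥ x) := fun x => by
    conv_lhs => rw [← hPe]
    rw [tr, dotProduct_comm]
  have d1 : ∀ a b : Fin 1 → ℝ, a ⬝ᵥ b = a 0 * b 0 := fun a b => by
    simp [dotProduct]
  simp only [matPsi, symBlock_quadraticForm, fromCols_mulVec_sumElim]
  simp only [add_mulVec, sub_mulVec, neg_mulVec, smul_mulVec, zero_mulVec, one_mulVec,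
    ← mulVec_mulVec, transpose_add, transpose_sub, transpose_smul, transpose_mul, mulVec_add,
    mulVec_sub, mulVec_smul, dotProduct_add, add_dotProduct, dotProduct_sub,
    sub_dotProduct, dotProduct_neg, dotProduct_smul, smul_dotProduct,
    dotProduct_zero, smul_eq_mul, smul_add, smul_sub, hX, tr, sX, sPz, sPe]
  simp only [d1]
  ring

/-! ### Quadratic forms -/

section QuadraticForms
open Matrix

variable {n : ℕ} {P : Matrix (Fin n) (Fin n) ℝ}

theorem _root_.Matrix.PosDef.transpose_eq (hP : P.PosDef) : Pᵀ = P := by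
  have := hP.isHermitian
  rwa [IsHermitian, conjTranspose_eq_transpose_of_trivial] at this

theorem dotProduct_mulVec_comm (hP : Pᵀ = P) (x y : Fin n → ℝ) :
    x ⬝ᵥ (P *ᵥ y) = y ⬝ᵥ (P *ᵥ x) := by
  conv_lhs => rw [← hP]
  rw [mulVec_transpose, dotProduct_comm, dotProduct_mulVec]

theorem _root_.Matrix.PosSemidef.quadraticForm_nonneg {m : Type*} [Fintype m] {M : Matrix m m ℝ}
    (hM : M.PosSemidef) (x : m → ℝ) : 0 ≤ x ⬝ᵥ (M *ᵥ x) := by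
  simpa using hM.dotProduct_mulVec_nonneg x

theorem quadraticForm_le (P : Matrix (Fin n) (Fin n) ℝ) :
    ∃ M : ℝ, 0 < M ∧ ∀ x : Fin n → ℝ, x ⬝ᵥ (P *ᵥ x) ≤ M * (x ⬝ᵥ x) := by
  refine ⟨∑ i, ∑ j, |P i j| + 1, by positivity, fun x => ?_⟩
  have hsq : ∀ i, x i ^ 2 ≤ x ⬝ᵥ x := fun i => by
    rw [dotProduct]
    simp only [← sq]
    exact Finset.single_le_sum (f := fun i => x i ^ 2) (fun _ _ => sq_nonneg _)
      (Finset.mem_univ i)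
  have h0 : 0 ≤ x ⬝ᵥ x := Finset.sum_nonneg fun i _ => mul_self_nonneg _
  calc x ⬝ᵥ (P *ᵥ x) = ∑ i, ∑ j, P i j * (x i * x j) := by
        simp only [dotProduct, mulVec, Finset.mul_sum]
        exact Finset.sum_congr rfl fun i _ => Finset.sum_congr rfl fun j _ => by ring
    _ ≤ ∑ i, ∑ j, |P i j| * (x ⬝ᵥ x) := by
        refine Finset.sum_le_sum fun i _ => Finset.sum_le_sum fun j _ => ?_
        refine (le_abs_self _).trans ?_
        rw [abs_mul]
        refine mul_le_mul_of_nonneg_left ?_ (abs_nonneg _)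
        rw [abs_le]
        constructor <;> nlinarith [hsq i, hsq j, sq_nonneg (x i - x j), sq_nonneg (x i + x j)]
    _ ≤ (∑ i, ∑ j, |P i j| + 1) * (x ⬝ᵥ x) := by
        simp only [← Finset.sum_mul]
        nlinarith

/-- An upper bound `M` for the form of `P⁻¹` gives the lower bound `1/M` for that of `P`: expand the
nonnegative form of `P` at `x - (1/M) P⁻¹ x`. -/
theorem _root_.Matrix.PosDef.le_quadraticForm (hP : P.PosDef) :
    ∃ m : ℝ, 0 < m ∧ ∀ x : Fin n → ℝ, m * (x ⬝ᵥ x) ≤ x ⬝ᵥ (P *ᵥ x) := by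
  obtain ⟨M, hM, hle⟩ := quadraticForm_le P⁻¹
  refine ⟨1 / M, by positivity, fun x => ?_⟩
  have hdet : IsUnit P.det := (isUnit_iff_isUnit_det P).1 hP.isUnit
  have hPw : P *ᵥ (P⁻¹ *ᵥ x) = x := by rw [mulVec_mulVec, mul_nonsing_inv P hdet, one_mulVec]
  have h := hP.posSemidef.quadraticForm_nonneg (x - (1 / M) • (P⁻¹ *ᵥ x))
  have hx := hle x
  have hc : (P⁻¹ *ᵥ x) ⬝ᵥ (P *ᵥ x) = x ⬝ᵥ x := by
    rw [dotProduct_mulVec_comm hP.transpose_eq, hPw]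
  rw [mulVec_sub, mulVec_smul, hPw] at h
  simp only [dotProduct_sub, sub_dotProduct, smul_dotProduct, dotProduct_smul, smul_eq_mul,
    hc] at h
  rw [dotProduct_comm (P⁻¹ *ᵥ x) x] at h
  have h2 : 1 / M * (1 / M * (x ⬝ᵥ (P⁻¹ *ᵥ x))) ≤ 1 / M * (x ⬝ᵥ x) := by
    refine mul_le_mul_of_nonneg_left ?_ (by positivity)
    rw [one_div, inv_mul_le_iff₀ hM]
    exact hx
  linarith

theorem hasDerivAt_dotProduct {u v : ℝ → Fin n → ℝ} {u' v' : Fin n → ℝ} {s : ℝ}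
    (hu : HasDerivAt u u' s) (hv : HasDerivAt v v' s) :
    HasDerivAt (fun s => u s ⬝ᵥ v s) (u' ⬝ᵥ v s + u s ⬝ᵥ v') s := by
  simp only [dotProduct, ← Finset.sum_add_distrib]
  exact HasDerivAt.fun_sum fun i _ => (hasDerivAt_pi.1 hu i).mul (hasDerivAt_pi.1 hv i)

theorem hasDerivAt_quadraticForm (hP : Pᵀ = P) {u : ℝ → Fin n → ℝ} {u' : Fin n → ℝ} {s : ℝ}
    (hu : HasDerivAt u u' s) :
    HasDerivAt (fun s => u s ⬝ᵥ (P *ᵥ u s)) (2 * (u s ⬝ᵥ (P *ᵥ u'))) s := by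
  have hPu : HasDerivAt (fun s => P *ᵥ u s) (P *ᵥ u') s := by
    exact (P.mulVecLin.toContinuousLinearMap.hasFDerivAt (x := u s)).comp_hasDerivAt s hu
  convert! hasDerivAt_dotProduct hu hPu using 1
  rw [dotProduct_mulVec_comm hP u' (u s)]
  ring

end QuadraticForms

/-! ### A comparison principle between sampling instants -/

/-- If `Q` is a squared sampling error, then Wirtinger's inequality absorbs the term
`-(π/2)² Q + h² D`, where `D` is the squared norm of the rate of change. -/
theorem le_left_of_deriv_le_sampling {a b h : ℝ} (hh : 0 < h) (hab : b - a ≤ h)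
    {V V' Q Q' D : ℝ → ℝ} (hV : ContinuousOn V (Icc a b)) (hQ : ContinuousOn Q (Icc a b))
    (hV' : ∀ s ∈ Ioo a b, HasDerivAt V (V' s) s) (hQ' : ∀ s ∈ Ioo a b, HasDerivAt Q (Q' s) s)
    (hQa : Q a = 0) (hQ0 : ∀ s, 0 ≤ Q s)
    (hQD : ∀ s ∈ Ioo a b, ∀ κ : ℝ, κ * Q' s ≤ κ ^ 2 * Q s + D s)
    (hVD : ∀ s ∈ Ioo a b, V' s - Real.pi ^ 2 / 4 * Q s + h ^ 2 * D s ≤ 0) :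
    ∀ s ∈ Icc a b, V s ≤ V a := by
  intro s hs
  rcases hs.1.eq_or_lt with rfl | has
  · exact le_rfl
  set ν : ℝ := Real.pi / (2 * h) with hν
  have hν0 : 0 < ν := by positivity
  have hνh : ν * h = Real.pi / 2 := by rw [hν]; field_simp
  -- `κ = ν cot(ν(τ - a + δ))` solves the Riccati equation `κ' = -ν² - κ²`, and `h²ν² = π²/4`. Hence
  -- `V + h² κ Q` is nonincreasing: `κ Q' ≤ κ² Q + D` cancels the `κ²` term. The shift `δ > 0` keeps
  -- the pole of the cotangent away from `a`.
  set κ : ℝ → ℝ → ℝ := fun δ τ =>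
    ν * (Real.cos (ν * (τ - a + δ)) / Real.sin (ν * (τ - a + δ))) with hκ
  have hsin : ∀ δ, 0 ≤ δ → δ < h → ∀ τ, 0 < τ - a + δ → τ ≤ b →
      0 < Real.sin (ν * (τ - a + δ)) := by
    intro δ h0 h1 τ h2 h3
    refine Real.sin_pos_of_pos_of_lt_pi (mul_pos hν0 h2) ?_
    have : ν * (τ - a + δ) < ν * (h + h) := mul_lt_mul_of_pos_left (by linarith) hν0
    linarith
  have hκd : ∀ δ τ, Real.sin (ν * (τ - a + δ)) ≠ 0 →
      HasDerivAt (κ δ) (-ν ^ 2 - κ δ τ ^ 2) τ := by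
    intro δ τ hne
    have h1 : HasDerivAt (fun τ => ν * (τ - a + δ)) ν τ := by
      simpa using (((hasDerivAt_id τ).sub_const a).add_const δ).const_mul ν
    convert! (h1.cos.div h1.sin hne).const_mul ν using 1
    simp only [hκ]
    field_simp
  have hstep : ∀ δ, 0 < δ → δ < h → V s + h ^ 2 * (κ δ s * Q s) ≤ V a := by
    intro δ h0 h1
    have hne : ∀ τ ∈ Icc a b, Real.sin (ν * (τ - a + δ)) ≠ 0 := fun τ hτ =>
      (hsin δ h0.le h1 τ (by linarith [hτ.1]) hτ.2).ne'
    have hU : ∀ τ ∈ Ioo a b, HasDerivAt (fun τ => V τ + h ^ 2 * (κ δ τ * Q τ))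
        (V' τ + h ^ 2 * ((-ν ^ 2 - κ δ τ ^ 2) * Q τ + κ δ τ * Q' τ)) τ := fun τ hτ =>
      (hV' τ hτ).add (((hκd δ τ (hne τ (Ioo_subset_Icc_self hτ))).mul (hQ' τ hτ)).const_mul _)
    have hanti : AntitoneOn (fun τ => V τ + h ^ 2 * (κ δ τ * Q τ)) (Icc a b) := by
      refine antitoneOn_of_deriv_nonpos (convex_Icc a b) ?_ ?_ ?_
      · refine hV.add (continuousOn_const.mul (ContinuousOn.mul (fun τ hτ => ?_) hQ))
        exact (hκd δ τ (hne τ hτ)).continuousAt.continuousWithinAt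
      · rw [interior_Icc]
        exact fun τ hτ => (hU τ hτ).differentiableAt.differentiableWithinAt
      · rw [interior_Icc]
        intro τ hτ
        rw [(hU τ hτ).deriv]
        have e1 : h ^ 2 * ν ^ 2 = Real.pi ^ 2 / 4 := by rw [← mul_pow, mul_comm, hνh]; ring
        have e2 := mul_le_mul_of_nonneg_left (hQD τ hτ (κ δ τ)) (sq_nonneg h)
        have e3 := hVD τ hτ
        rw [← e1] at e3
        nlinarith
    have := hanti ⟨le_rfl, has.le.trans hs.2⟩ hs hs.1
    simpa [hQa] using this
  have hlim : Tendsto (fun δ => V s + h ^ 2 * (κ δ s * Q s)) (𝓝[>] 0)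
      (𝓝 (V s + h ^ 2 * (κ 0 s * Q s))) := by
    have hne := (hsin 0 le_rfl hh s (by linarith) hs.2).ne'
    have : ContinuousAt (fun δ => V s + h ^ 2 * (κ δ s * Q s)) 0 := by
      simp only [hκ]
      refine ContinuousAt.add continuousAt_const (continuousAt_const.mul
        (ContinuousAt.mul (continuousAt_const.mul (ContinuousAt.div ?_ ?_ hne))
          continuousAt_const))
      · fun_prop
      · fun_prop
    exact this.tendsto.mono_left nhdsWithin_le_nhds
  have hfin : V s + h ^ 2 * (κ 0 s * Q s) ≤ V a := by
    refine le_of_tendsto hlim ?_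
    filter_upwards [Ioo_mem_nhdsGT hh] with δ hδ
    exact hstep δ hδ.1 hδ.2
  -- `ν (s - a) ≤ ν h = π/2`, so the cotangent is nonnegative; this is where the bound on the
  -- sampling step enters with its sharp constant.
  have hκ0 : 0 ≤ κ 0 s := by
    refine mul_nonneg hν0.le (div_nonneg ?_ (hsin 0 le_rfl hh s (by linarith) hs.2).le)
    have h1 : ν * (s - a + 0) ≤ ν * h := mul_le_mul_of_nonneg_left (by linarith [hs.2]) hν0.le
    have h2 : 0 ≤ ν * (s - a + 0) := mul_nonneg hν0.le (by linarith)
    exact Real.cos_nonneg_of_mem_Icc ⟨by linarith [Real.pi_pos], by linarith⟩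
  nlinarith [mul_nonneg (sq_nonneg h) (mul_nonneg hκ0 (hQ0 s))]

/-! ### Dissipation along the closed loop -/

/-- The vector `z^N` of the first `N` Fourier coefficients. -/
noncomputable def modes (N : ℕ) (w : L2) : Fin N → ℝ := fun n => fourierMode w n

theorem modes_dotProduct_self_le (N : ℕ) (w : L2) : modes N w ⬝ᵥ modes N w ≤ ‖w‖ ^ 2 := by
  have h := sum_le_hasSum (Finset.range N) (fun _ _ => sq_nonneg _) (hasSum_fourierMode_sq w)
  rw [Finset.sum_range] at h
  simpa only [modes, dotProduct, ← sq] using h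

theorem hasDerivAt_modes {N : ℕ} {z : ℝ → L2} {z' : L2} {s : ℝ} (h : HasDerivAt z z' s) :
    HasDerivAt (fun s => modes N (z s)) (modes N z') s := by
  refine hasDerivAt_pi.2 fun n => ?_
  simp only [modes, ← modeCLM_apply]
  exact (modeCLM n).hasFDerivAt.comp_hasDerivAt s h

theorem continuous_modes (N : ℕ) : Continuous (modes N) := by
  refine continuous_pi fun n => ?_
  simp only [modes, ← modeCLM_apply]
  exact (modeCLM n).continuous

open Matrix in
theorem closedLoop_dissipation {q σ γ h : ℝ} {N : ℕ} (hq : 0 < q) (hσ : 0 < σ)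
    (hN : q + σ < eigval N) (hγ : γ = gain q σ N) {K : Matrix (Fin 1) (Fin N) ℝ}
    {L : Matrix (Fin N) (Fin 1) ℝ} {X Pz Pe Wz We : Matrix (Fin N) (Fin N) ℝ} (hX : Xᵀ = X)
    (hPz : Pzᵀ = Pz) (hPe : Peᵀ = Pe)
    (hΨ : (-(matPsi σ γ h (matA q N) (matB N) (matC N) K L X Pz Pe Wz We)).PosSemidef)
    {w wxx φ : L2} {y u : ℝ} {what what₀ zN₀ what' : Fin N → ℝ} (hu : u = -(K *ᵥ what₀) 0)
    (hxx : ∀ n, fourierMode wxx n = eigfun n Real.pi * u - eigval n * fourierMode w n)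
    (hy : HasPointValue w 0 y) (hφ : ‖φ‖ ≤ σ * ‖w‖)
    (hw' : what' = (matA q N + (γ * σ) • X) *ᵥ what + matB N *ᵥ (fun _ => u)
        - L *ᵥ (matC N *ᵥ what - fun _ => y)) {e vz ve zd ed : Fin N → ℝ}
    (he : e = what - modes N w) (hvz : vz = zN₀ - modes N w) (hve : ve = what₀ - zN₀ - e)
    (hzd : zd = modes N (wxx + q • w + φ)) (hed : ed = what' - zd) :
    2 * (modes N w ⬝ᵥ (Pz *ᵥ zd)) + 2 * (e ⬝ᵥ (Pe *ᵥ ed))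
      + 1 / γ * (2 * inner ℝ w (wxx + q • w + φ) - 2 * (modes N w ⬝ᵥ zd))
      - Real.pi ^ 2 / 4 * (vz ⬝ᵥ (Wz *ᵥ vz) + ve ⬝ᵥ (We *ᵥ ve))
      + h ^ 2 * (zd ⬝ᵥ (Wz *ᵥ zd) + ed ⬝ᵥ (We *ᵥ ed)) ≤ 0 := by
  have hγ0 : 0 < γ := hγ ▸ gain_pos hN
  have hγσ : γ * σ ≠ 0 := (mul_pos hγ0 hσ).ne'
  set F := modes N φ with hF
  set ζ : Fin 1 → ℝ := (fun _ => y) - matC N *ᵥ modes N w with hζ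
  have hKu : (fun _ => u) = -(K *ᵥ what₀) := by
    ext i
    rw [Subsingleton.elim i 0, hu, Pi.neg_apply]
  -- The sum telescopes to the sampled observer state, so `u` is a linear function of the arguments
  -- of `Ψ`.
  have hsum : modes N w + e + vz + ve = what₀ := by rw [hve, hvz, he]; abel
  have hF' : (γ * σ) • ((γ * σ)⁻¹ • F) = F := smul_inv_smul₀ hγσ F
  have hzd' : zd = matA q N *ᵥ modes N w - matB N *ᵥ (K *ᵥ (modes N w + e + vz + ve))
      + (γ * σ) • ((γ * σ)⁻¹ • F) := by
    rw [hF', hsum, sub_eq_add_neg, ← mulVec_neg, ← hKu, hzd]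
    ext n
    have h1 : (matA q N *ᵥ modes N w) n = (q - eigval n) * fourierMode w n := by
      rw [matA, mulVec_diagonal, modes]
    have h2 : (matB N *ᵥ fun _ => u) n = eigfun n Real.pi * u := by
      simp [matB, mulVec, dotProduct]
    rw [Pi.add_apply, Pi.add_apply, h1, h2, hF]
    simp only [modes]
    rw [fourierMode_add, fourierMode_add, fourierMode_smul, hxx]
    ring
  have hed' : ed = matA q N *ᵥ e - L *ᵥ (matC N *ᵥ e) + (γ * σ) • (X *ᵥ (modes N w + e))
      + L *ᵥ ζ - (γ * σ) • ((γ * σ)⁻¹ • F) := by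
    have hwe : what = modes N w + e := by rw [he]; abel
    rw [hed, hzd', hw', hsum, hKu, hF', hwe, hζ]
    simp only [add_mulVec, mulVec_add, mulVec_sub, mulVec_neg, smul_mulVec, smul_add]
    abel
  have hres := residue_dissipation (φ := φ) hq hσ hN hγ hxx hy
  -- The last two slots are `h z^N'` and `h e'`: at `p = h a` the terms `2h a·Wp - p·Wp` equal `h²
  -- a·Wa`, which plays the role of a Schur complement.
  have hpsi := hΨ.quadraticForm_nonneg (Sum.elim (modes N w) (Sum.elim e
    (Sum.elim ((γ * σ)⁻¹ • F) (Sum.elim ζ (Sum.elim vz (Sum.elim ve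
      (Sum.elim (h • zd) (h • ed))))))))
  rw [neg_mulVec, dotProduct_neg, matPsi_quadraticForm hX hPz hPe, ← hzd', ← hed', hsum] at hpsi
  have e1 : (K *ᵥ what₀) ⬝ᵥ (K *ᵥ what₀) = u ^ 2 := by
    rw [hu]
    simp [dotProduct, sq]
  have e2 : ζ ⬝ᵥ ζ = (y - ∑ n : Fin N, eigfun n 0 * fourierMode w n) ^ 2 := by
    simp [hζ, dotProduct, matC, mulVec, modes, sq]
  have e3 : ∑ n : Fin N, fourierMode w n * fourierMode (wxx + q • w + φ) n
      = modes N w ⬝ᵥ zd := by rw [hzd]; rfl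
  have e4 : ∑ n : Fin N, fourierMode w n ^ 2 = modes N w ⬝ᵥ modes N w := by
    simp only [dotProduct, modes, sq]
  have e5 : ∑ n : Fin N, fourierMode φ n ^ 2 = F ⬝ᵥ F := by
    simp only [hF, dotProduct, modes, sq]
  have e6 : γ * σ * (((γ * σ)⁻¹ • F) ⬝ᵥ ((γ * σ)⁻¹ • F)) = 1 / (γ * σ) * (F ⬝ᵥ F) := by
    rw [smul_dotProduct, dotProduct_smul, smul_eq_mul, smul_eq_mul]
    field_simp
  -- The Lipschitz bound is used over all modes at once. Added to the residue estimate it cancels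
  -- the full norms and leaves exactly the `(σ/γ)|z^N|²` and `-|F|²/(γσ)` terms of `Ψ`.
  have e7 : 1 / (γ * σ) * ‖φ‖ ^ 2 ≤ σ / γ * ‖w‖ ^ 2 := by
    have : ‖φ‖ ^ 2 ≤ (σ * ‖w‖) ^ 2 := pow_le_pow_left₀ (norm_nonneg _) hφ 2
    calc 1 / (γ * σ) * ‖φ‖ ^ 2 ≤ 1 / (γ * σ) * (σ * ‖w‖) ^ 2 :=
          mul_le_mul_of_nonneg_left this (by positivity)
      _ = σ / γ * ‖w‖ ^ 2 := by field_simp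
  have e8 : 1 / γ * (2 * inner ℝ w (wxx + q • w + φ) - 2 * (modes N w ⬝ᵥ zd))
      = 2 / γ * (inner ℝ w (wxx + q • w + φ) - modes N w ⬝ᵥ zd) := by ring
  rw [e3, e4, e5, ← e2] at hres
  rw [e1, e6] at hpsi
  simp only [mulVec_smul, dotProduct_smul, smul_dotProduct, smul_eq_mul] at hpsi
  rw [e8]
  linarith

/-! ### Bounds on the Lyapunov functional, within and across sampling intervals -/

theorem IsSampling.nonneg {h : ℝ} {t : ℕ → ℝ} (ht : IsSampling h t) (k : ℕ) : 0 ≤ t k :=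
  ht.zero ▸ ht.strictMono.monotone (Nat.zero_le k)

theorem IsSampling.exists_mem_Icc {h : ℝ} {t : ℕ → ℝ} (ht : IsSampling h t) {s : ℝ}
    (hs : 0 ≤ s) : ∃ k, s ∈ Icc (t k) (t (k + 1)) := by
  classical
  have hex : ∃ m, s < t m := (ht.tendsto.eventually_gt_atTop s).exists
  have hm := Nat.find_spec hex
  obtain ⟨k, hk⟩ : ∃ k, Nat.find hex = k + 1 := by
    refine Nat.exists_eq_succ_of_ne_zero fun h0 => ?_
    rw [h0, ht.zero] at hm
    exact hm.not_ge hs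
  refine ⟨k, not_lt.1 (Nat.find_min hex (by omega)), ?_⟩
  rw [← hk]
  exact hm.le

/-- The Lyapunov functional at sampling instants. -/
noncomputable def lyapunov {N : ℕ} (γ : ℝ) (Pz Pe : Matrix (Fin N) (Fin N) ℝ) (w : L2)
    (what : Fin N → ℝ) : ℝ :=
  modes N w ⬝ᵥ (Pz *ᵥ modes N w) + (what - modes N w) ⬝ᵥ (Pe *ᵥ (what - modes N w))
    + 1 / γ * (‖w‖ ^ 2 - modes N w ⬝ᵥ modes N w)

open Matrix in
theorem lyapunov_le_left {q σ γ h : ℝ} {N : ℕ} (hq : 0 < q) (hσ : 0 < σ) (hh : 0 < h)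
    (hN : q + σ < eigval N) (hγ : γ = gain q σ N) {K : Matrix (Fin 1) (Fin N) ℝ}
    {L : Matrix (Fin N) (Fin 1) ℝ} {X Pz Pe Wz We : Matrix (Fin N) (Fin N) ℝ} (hX : Xᵀ = X)
    (hPz : Pzᵀ = Pz) (hPe : Peᵀ = Pe) (hWz : Wz.PosDef) (hWe : We.PosDef)
    (hΨ : (-(matPsi σ γ h (matA q N) (matB N) (matC N) K L X Pz Pe Wz We)).PosSemidef)
    {f : ℝ → L2 → L2} (hf : IsAdmissibleNonlinearity σ f) {t : ℕ → ℝ} (ht : IsSampling h t)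
    {z : ℝ → L2} {y : ℝ → ℝ} {zhat : ℝ → Fin N → ℝ}
    (hsol : IsClosedLoopSolution q σ γ X K L f t z y zhat) (k : ℕ) :
    ∀ s ∈ Icc (t k) (t (k + 1)),
      lyapunov γ Pz Pe (z s) (zhat s) ≤ lyapunov γ Pz Pe (z (t k)) (zhat (t k)) := by
  have hsub : Icc (t k) (t (k + 1)) ⊆ Ici 0 := fun s hs => (ht.nonneg k).trans hs.1
  have hzc : ContinuousOn z (Icc (t k) (t (k + 1))) := hsol.plant.continuousOn.mono hsub
  have hhc : ContinuousOn zhat (Icc (t k) (t (k + 1))) := hsol.observer.continuousOn.mono hsub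
  have hmc : ContinuousOn (fun s => modes N (z s)) (Icc (t k) (t (k + 1))) :=
    (continuous_modes N).comp_continuousOn hzc
  have hquad : ∀ (P : Matrix (Fin N) (Fin N) ℝ) {v : ℝ → Fin N → ℝ},
      ContinuousOn v (Icc (t k) (t (k + 1))) →
      ContinuousOn (fun s => v s ⬝ᵥ (P *ᵥ v s)) (Icc (t k) (t (k + 1))) := by
    intro P v hv
    have : Continuous fun x : Fin N → ℝ => x ⬝ᵥ (P *ᵥ x) :=
      continuous_id.dotProduct (continuous_const.matrix_mulVec continuous_id)
    exact this.comp_continuousOn hv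
  -- The derivatives are packaged as functions of `s` for the comparison principle; outside the open
  -- interval their values are irrelevant and set to zero.
  have hloc : ∀ s, ∃ zd : L2, ∃ hd : Fin N → ℝ, s ∈ Ioo (t k) (t (k + 1)) →
      HasDerivAt z zd s ∧ HasDerivAt zhat hd s ∧
      2 * (modes N (z s) ⬝ᵥ (Pz *ᵥ modes N zd))
        + 2 * ((zhat s - modes N (z s)) ⬝ᵥ (Pe *ᵥ (hd - modes N zd)))
        + 1 / γ * (2 * inner ℝ (z s) zd - 2 * (modes N (z s) ⬝ᵥ modes N zd))
        - Real.pi ^ 2 / 4 * ((modes N (z (t k)) - modes N (z s)) ⬝ᵥ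
            (Wz *ᵥ (modes N (z (t k)) - modes N (z s)))
          + (zhat (t k) - modes N (z (t k)) - (zhat s - modes N (z s))) ⬝ᵥ
            (We *ᵥ (zhat (t k) - modes N (z (t k)) - (zhat s - modes N (z s)))))
        + h ^ 2 * (modes N zd ⬝ᵥ (Wz *ᵥ modes N zd)
          + (hd - modes N zd) ⬝ᵥ (We *ᵥ (hd - modes N zd))) ≤ 0 := by
    intro s
    by_cases hs : s ∈ Ioo (t k) (t (k + 1))
    · have hs0 : 0 < s := (ht.nonneg k).trans_lt hs.1
      obtain ⟨zx, zxx, h1, h2, h3, h4, h5⟩ := hsol.plant.equation k s hs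
      have hy := hsol.output s hs0
      have hφ : ‖f s (z s)‖ ≤ σ * ‖z s‖ := by
        simpa [hf.map_zero s hs0.le] using hf.lipschitz s hs0.le (z s) 0
      exact ⟨_, _, fun _ => ⟨h5, hsol.observer.equation k s hs,
        closedLoop_dissipation hq hσ hN hγ hX hPz hPe hΨ rfl
          (fourierMode_weakDeriv_weakDeriv h1 h2 hy h3 h4) hy hφ rfl rfl rfl rfl rfl rfl⟩⟩
    · exact ⟨0, 0, fun h => absurd h hs⟩
  choose zd hd hder using hloc
  -- Nonnegativity of the form of `W` at `κ v + v'`; the minus sign appears because the sampling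
  -- error `v` has derivative `-v'`.
  have hκ : ∀ {W : Matrix (Fin N) (Fin N) ℝ}, W.PosDef → ∀ (κ : ℝ) (v v' : Fin N → ℝ),
      κ * (2 * (v ⬝ᵥ (W *ᵥ -v'))) ≤ κ ^ 2 * (v ⬝ᵥ (W *ᵥ v)) + v' ⬝ᵥ (W *ᵥ v') := by
    intro W hW κ v v'
    have := hW.posSemidef.quadraticForm_nonneg (κ • v + v')
    rw [mulVec_add, mulVec_smul] at this
    simp only [add_dotProduct, dotProduct_add, smul_dotProduct, dotProduct_smul, smul_eq_mul] at this
    rw [dotProduct_mulVec_comm hW.transpose_eq v' v] at this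
    rw [mulVec_neg, dotProduct_neg]
    linarith
  refine le_left_of_deriv_le_sampling (h := h) hh (ht.step_le k)
    (V := fun s => lyapunov γ Pz Pe (z s) (zhat s))
    (V' := fun s => 2 * (modes N (z s) ⬝ᵥ (Pz *ᵥ modes N (zd s)))
      + 2 * ((zhat s - modes N (z s)) ⬝ᵥ (Pe *ᵥ (hd s - modes N (zd s))))
      + 1 / γ * (2 * inner ℝ (z s) (zd s) - 2 * (modes N (z s) ⬝ᵥ modes N (zd s))))
    (Q := fun s => (modes N (z (t k)) - modes N (z s)) ⬝ᵥ
        (Wz *ᵥ (modes N (z (t k)) - modes N (z s)))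
      + (zhat (t k) - modes N (z (t k)) - (zhat s - modes N (z s))) ⬝ᵥ
        (We *ᵥ (zhat (t k) - modes N (z (t k)) - (zhat s - modes N (z s)))))
    (Q' := fun s => 2 * ((modes N (z (t k)) - modes N (z s)) ⬝ᵥ (Wz *ᵥ -modes N (zd s)))
      + 2 * ((zhat (t k) - modes N (z (t k)) - (zhat s - modes N (z s))) ⬝ᵥ
        (We *ᵥ -(hd s - modes N (zd s)))))
    (D := fun s => modes N (zd s) ⬝ᵥ (Wz *ᵥ modes N (zd s))
      + (hd s - modes N (zd s)) ⬝ᵥ (We *ᵥ (hd s - modes N (zd s))))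
    ?_ ?_ ?_ ?_ ?_ ?_ ?_ ?_
  · unfold lyapunov
    have hself : ContinuousOn (fun s => modes N (z s) ⬝ᵥ modes N (z s))
        (Icc (t k) (t (k + 1))) := by simpa using hquad 1 hmc
    exact ((hquad Pz hmc).add (hquad Pe (hhc.sub hmc))).add
      (continuousOn_const.mul ((hzc.norm.pow 2).sub hself))
  · exact (hquad Wz (continuousOn_const.sub hmc)).add
      (hquad We (continuousOn_const.sub (hhc.sub hmc)))
  · intro s hs
    obtain ⟨h1, h2, -⟩ := hder s hs
    have hm := hasDerivAt_modes (N := N) h1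
    unfold lyapunov
    have h3 : HasDerivAt (fun s => modes N (z s) ⬝ᵥ modes N (z s))
        (2 * (modes N (z s) ⬝ᵥ modes N (zd s))) s := by
      simpa using hasDerivAt_quadraticForm (P := 1) transpose_one hm
    exact ((hasDerivAt_quadraticForm hPz hm).add (hasDerivAt_quadraticForm hPe (h2.sub hm))).add
      ((h1.norm_sq.sub h3).const_mul _)
  · intro s hs
    obtain ⟨h1, h2, -⟩ := hder s hs
    have hm := hasDerivAt_modes (N := N) h1
    exact (hasDerivAt_quadraticForm hWz.transpose_eq (hm.const_sub _)).add
      (hasDerivAt_quadraticForm hWe.transpose_eq ((h2.sub hm).const_sub _))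
  · simp
  · exact fun s => add_nonneg (hWz.posSemidef.quadraticForm_nonneg _)
      (hWe.posSemidef.quadraticForm_nonneg _)
  · intro s _ κ
    have h1 := hκ hWz κ (modes N (z (t k)) - modes N (z s)) (modes N (zd s))
    have h2 := hκ hWe κ (zhat (t k) - modes N (z (t k)) - (zhat s - modes N (z s)))
      (hd s - modes N (zd s))
    linarith
  · exact fun s hs => (hder s hs).2.2

theorem lyapunov_le_zero {h γ : ℝ} {N : ℕ} {Pz Pe : Matrix (Fin N) (Fin N) ℝ} {t : ℕ → ℝ}
    (ht : IsSampling h t) {z : ℝ → L2} {zhat : ℝ → Fin N → ℝ}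
    (hle : ∀ k, ∀ s ∈ Icc (t k) (t (k + 1)),
      lyapunov γ Pz Pe (z s) (zhat s) ≤ lyapunov γ Pz Pe (z (t k)) (zhat (t k)))
    {s : ℝ} (hs : 0 ≤ s) :
    lyapunov γ Pz Pe (z s) (zhat s) ≤ lyapunov γ Pz Pe (z 0) (zhat 0) := by
  have hk : ∀ k, lyapunov γ Pz Pe (z (t k)) (zhat (t k))
      ≤ lyapunov γ Pz Pe (z 0) (zhat 0) := by
    intro k
    induction k with
    | zero => rw [ht.zero]
    | succ k ih =>
      exact (hle k _ (right_mem_Icc.2 (ht.strictMono (Nat.lt_succ_self k)).le)).trans ih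
  obtain ⟨k, hsk⟩ := ht.exists_mem_Icc hs
  exact (hle k s hsk).trans (hk k)

theorem errorSq_eq {N : ℕ} (w : L2) (what : Fin N → ℝ) :
    errorSq w what = (what - modes N w) ⬝ᵥ (what - modes N w) := by
  simp only [errorSq, dotProduct, modes, Pi.sub_apply, sq]

/-- The residue term controls `‖w‖² - |z^N|²`, and the form of `Pz` restores the missing `|z^N|²`;
hence the minimum of the three constants. -/
theorem exists_le_lyapunov {N : ℕ} {γ : ℝ} (hγ : 0 < γ) {Pz Pe : Matrix (Fin N) (Fin N) ℝ}
    (hPz : Pz.PosDef) (hPe : Pe.PosDef) :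
    ∃ m : ℝ, 0 < m ∧ ∀ w what, m * (‖w‖ ^ 2 + errorSq w what) ≤ lyapunov γ Pz Pe w what := by
  obtain ⟨m₁, h₁, hle₁⟩ := hPz.le_quadraticForm
  obtain ⟨m₂, h₂, hle₂⟩ := hPe.le_quadraticForm
  refine ⟨min (1 / γ) (min m₁ m₂), lt_min (one_div_pos.2 hγ) (lt_min h₁ h₂), fun w what => ?_⟩
  set m := min (1 / γ) (min m₁ m₂) with hm
  have c0 : m ≤ 1 / γ := min_le_left _ _
  have c1 : m ≤ m₁ := (min_le_right _ _).trans (min_le_left _ _)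
  have c2 : m ≤ m₂ := (min_le_right _ _).trans (min_le_right _ _)
  have n1 : 0 ≤ modes N w ⬝ᵥ modes N w := Finset.sum_nonneg fun i _ => mul_self_nonneg _
  have n2 : 0 ≤ (what - modes N w) ⬝ᵥ (what - modes N w) :=
    Finset.sum_nonneg fun i _ => mul_self_nonneg _
  have n0 := sub_nonneg.2 (modes_dotProduct_self_le N w)
  rw [errorSq_eq, lyapunov]
  have := hle₁ (modes N w)
  have := hle₂ (what - modes N w)
  have := mul_le_mul_of_nonneg_right c0 n0
  have := mul_le_mul_of_nonneg_right c1 n1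
  have := mul_le_mul_of_nonneg_right c2 n2
  linarith

/-- With the observer at `0` the error is `-z^N`, so the whole functional is controlled by the plant
state alone. -/
theorem exists_lyapunov_le {N : ℕ} {γ : ℝ} (hγ : 0 < γ) (Pz Pe : Matrix (Fin N) (Fin N) ℝ) :
    ∃ M : ℝ, ∀ w, lyapunov γ Pz Pe w 0 ≤ M * ‖w‖ ^ 2 := by
  obtain ⟨M₁, h₁, hle₁⟩ := quadraticForm_le Pz
  obtain ⟨M₂, h₂, hle₂⟩ := quadraticForm_le Pe
  refine ⟨M₁ + M₂ + 1 / γ, fun w => ?_⟩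
  have n1 : 0 ≤ modes N w ⬝ᵥ modes N w := Finset.sum_nonneg fun i _ => mul_self_nonneg _
  have n0 := modes_dotProduct_self_le N w
  have c1 := hle₁ (modes N w)
  have c2 := hle₂ (modes N w)
  have := mul_le_mul_of_nonneg_left n0 h₁.le
  have := mul_le_mul_of_nonneg_left n0 h₂.le
  have := mul_nonneg (one_div_pos.2 hγ).le n1
  rw [lyapunov, zero_sub, Matrix.mulVec_neg, neg_dotProduct, dotProduct_neg, neg_neg]
  linarith

end HeatControl

theorem mainTheorem4 (q σ h : ℝ) (hq : 0 < q) (hσ : 0 < σ) (hh : 0 < h)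
    (N : ℕ) (hN : q + σ < eigval N)
    (γ : ℝ) (hγ : γ = gain q σ N)
    (X Z : Matrix (Fin N) (Fin N) ℝ) (hX : X.PosDef) (hZ : Z.PosDef)
    (hXric : IsStabilizingRiccatiSolution (matA q N)
      (matB N * (matB N).transpose - (γ * σ) • 1) ((σ / γ) • 1) X)
    (hZric : IsStabilizingRiccatiSolution (matA q N).transpose
      ((matC N).transpose * matC N - (γ * σ) • 1) ((σ / γ) • 1) Z)
    (hρ : specRad (X * Z) < ENNReal.ofReal (γ ^ 2)⁻¹)
    (K : Matrix (Fin 1) (Fin N) ℝ) (hK : K = gainK X)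
    (L : Matrix (Fin N) (Fin 1) ℝ) (hL : L = gainL γ X Z)
    (hLMI : ∃ Pz Pe Wz We : Matrix (Fin N) (Fin N) ℝ,
      Pz.PosDef ∧ Pe.PosDef ∧ Wz.PosDef ∧ We.PosDef ∧
      (-(matPsi σ γ h (matA q N) (matB N) (matC N) K L X Pz Pe Wz We)).PosSemidef) :
    ∃ M : ℝ, 1 ≤ M ∧
      ∀ f : ℝ → L2 → L2, IsAdmissibleNonlinearity σ f →
      ∀ t : ℕ → ℝ, IsSampling h t →
      ∀ (z : ℝ → L2) (y : ℝ → ℝ) (zhat : ℝ → Fin N → ℝ),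
        IsClosedLoopSolution q σ γ X K L f t z y zhat →
        ∀ s : ℝ, 0 ≤ s → ‖z s‖ ^ 2 + errorSq (z s) (zhat s) ≤ M * ‖z 0‖ ^ 2 := by
  have hγ0 : 0 < γ := hγ ▸ gain_pos hN
  obtain ⟨Pz, Pe, Wz, We, hPz, hPe, hWz, hWe, hΨ⟩ := hLMI
  obtain ⟨m, hm, hlow⟩ := exists_le_lyapunov hγ0 hPz hPe
  obtain ⟨M, hupp⟩ := exists_lyapunov_le hγ0 Pz Pe
  -- The constant depends only on `γ`, `Pz` and `Pe`, which are fixed before `f`, the sampling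
  -- instants and the solution are introduced.
  refine ⟨max 1 (M / m), le_max_left _ _, fun f hf t ht z y zhat hsol s hs => ?_⟩
  have h1 := lyapunov_le_zero ht (lyapunov_le_left hq hσ hh hN hγ hX.transpose_eq
    hPz.transpose_eq hPe.transpose_eq hWz hWe hΨ hf ht hsol) hs
  rw [hsol.observer.init] at h1
  calc ‖z s‖ ^ 2 + errorSq (z s) (zhat s) ≤ M / m * ‖z 0‖ ^ 2 := by
        rw [div_mul_eq_mul_div, le_div_iff₀ hm, mul_comm]
        exact ((hlow _ _).trans h1).trans (hupp _)
    _ ≤ max 1 (M / m) * ‖z 0‖ ^ 2 :=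
        mul_le_mul_of_nonneg_right (le_max_right _ _) (sq_nonneg _)
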